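/- Let $0<q<1$ and $\lambda\in\mathbb R$. Put $(n)_q=\frac{1-q^n}{1-q}$, $(n)_q!=\prod_{k=1}^n (k)_q$, $(a;q)_k=\prod_{i=0}^{k-1}(1-aq^i)$, let $e_q^{x}=\sum_{k\ge 0}\frac{x^k}{(k)_q!}$, continued beyond the disc of convergence by $e_q^{x}=\prod_{k\ge 0}\bigl(1-(1-q)q^kx\bigr)^{-1}$, and let $$\Phi^q(a,b;x)=\sum_{k=0}^\infty \frac{q^{k(k-1)/2}(a;q)_k}{(q;q)_k(b;q)_k}\,((1-q)x)^k$$ be the $q$-Kummer function. *Operators.* On the span of an orthonormal basis $|n\rangle$, $n=0,1,2,\dots$, let $z|n\rangle=\sqrt{(n)_q}\,|n-1\rangle$, $z^*|n\rangle=\sqrt{(n+1)_q}\,|n+1\rangle$ and $\zeta=1-(1-q)z^*z$. On the span of the standard orthonormal basis $|l\rangle$, $l\in\mathbb Z$, of $\ell^2(\mathbb Z)$ let $B|l\rangle=q^{l/2}|l-1\rangle$, $B^*|l\rangle=q^{(l+1)/2}|l+1\rangle$, $A|l\rangle=|l-2\rangle$, $A^*=A^{-1}$, and let $\eta$ be the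 positive diagonal operator with $\eta^2=B^*B$, that is $\eta|l\rangle=q^{l/2}|l\rangle$. On the tensor product let $\delta(z^*)=B^*+A^*z^*$. *The functions $D^\lambda_j$.* For $j\ge 0$ let $f^\lambda_j(\zeta)=\frac{q^{j^2/4}(i\lambda)^j}{(j)_q!}\,\Phi^q(\zeta^{-1},q^{j+1};q^{j+1}\lambda^2\zeta)$; let $D^\lambda_j=f^\lambda_j(\zeta)z^j$ for $j\ge 0$, $D^\lambda_{j}=z^{*\,-j}f^\lambda_{-j}(\zeta)$ for $j\le 0$, and $(D^\lambda_j)_{mn}=\langle m|D^\lambda_j|n\rangle$. *The operators $t^\lambda_{ij}$.* For $i,j\in\mathbb Z$ let $$t^\lambda_{ij}=q^{\frac{i^2-j^2}{4}}\frac{(i\lambda B)^{i-j}A^j}{(i-j)_q!}\,\Phi^q\bigl(0,q^{1+i-j};(q-1)q^{1-j}(\lambda\eta)^2\bigr)\quad (i\ge j),$$ $$t^\lambda_{ij}=q^{\frac{i^2-j^2}{4}}\frac{A^j(i\lambda B^*)^{j-i}}{(j-i)_q!}\,\Phi^q\bigl(0,q^{1+j-i};(q-1)q^{1-i}(\lambda\eta)^2\bigr)\quad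 (j\ge i),$$ where $i$ in $i\lambda$ is the imaginary unit. These are the matrix elements of the irreducible representations of $E_q(2)$, i.e. Hahn–Exton $q$-Bessel functions of $\eta$. *The operators $U_{mn}$.* For $m,n\ge 0$ let $U_{mn}=\langle m|\,\delta(z^*)^n\,e_q^{-A^*Bz^*}\,|0\rangle\,\sqrt{e_q^{-B^*B}/(n)_q!}$, an operator on the span of the $|l\rangle$. **Claim.** (i) The $U_{mn}$ are given by $q$-Kummer functions: with $$\Phi_{mn}(\eta)=\sqrt{\frac{(n)_q!}{(m)_q!}}\,\frac{\sqrt{e_q^{-\eta^2}}}{(n-m)_q!}\,\Phi^q(q^{-m},q^{1+n-m};q^{n+1}\eta^2)\qquad(m\le n),$$ one has $U_{mn}=A^{-m}B^{*\,n-m}\Phi_{mn}(\eta)$ for $n\ge m$ and $U_{mn}=q^{\frac{(m-n)(m-n-1)}{2}}A^{-m}(-B)^{m-n}\Phi_{nm}(\eta)$ for $m\ge n$. (ii) For all $j\in\mathbb Z$ and all integers $m,n\ge 0$, $$\sum_{s=0}^\infty t^\lambda_{j,s-m}\,(D^\lambda_{s-m})_{ms}\,U_{sn}=\begin{cases}(D^\lambda_j)_{n-j,n}\,U_{m,n-j},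 & n\ge j,\\ 0, & n<j,\end{cases}$$ where the sum converges strongly on the span of the basis vectors $|l\rangle$: for every $v$ in that span, applying the terms to $v$ gives a series that converges unconditionally in the norm of $\ell^2(\mathbb Z)$ to the right-hand side applied to $v$. -/

import Mathlib

open scoped TensorProduct

noncomputable section

namespace QEuclid

/-! ### q-numbers, the q-exponential and the q-Kummer function -/

/-- The q-number `(n)_q = (1 - q^n) / (1 - q)`. -/
def qNum (q : ℝ) (n : ℕ) : ℝ := (1 - q ^ n) / (1 - q)

/-- The q-factorial `(n)_q! = (1)_q (2)_q ⋯ (n)_q`. -/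
def qFac (q : ℝ) (n : ℕ) : ℝ := ∏ k ∈ Finset.range n, qNum q (k + 1)

/-- The shifted factorial `(a; q)_k = ∏_{0 ≤ i < k} (1 - a q^i)`. -/
def qPoch (a q : ℝ) (k : ℕ) : ℝ := ∏ i ∈ Finset.range k, (1 - a * q ^ i)

/-- The q-exponential `e_q^x`. The series `∑ x^k / (k)_q!` has radius of convergence `1 / (1 - q)`;
its continuation to all real `x` (off its poles, which are positive) is the inverse of the product
`∏_{k ≥ 0} (1 - (1 - q) q^k x)`, see `hasSum_qExp`. -/
def qExp (q x : ℝ) : ℝ := (∏' k : ℕ, (1 - (1 - q) * q ^ k * x))⁻¹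

/-- The q-Kummer function
`Φ^q(a, b; x) = ∑_k q^{k(k-1)/2} (a; q)_k / ((q; q)_k (b; q)_k) ((1 - q) x)^k`. -/
def qKummer (q a b x : ℝ) : ℝ :=
  ∑' k : ℕ, q ^ (k * (k - 1) / 2) * qPoch a q k / (qPoch q q k * qPoch b q k) *
    ((1 - q) * x) ^ k

/-! ### The oscillator space, with basis `|n⟩`, and the operators on it -/

/-- The span of the basis `|n⟩`, `n = 0, 1, 2, …`. -/
abbrev OscSpace : Type := ℕ →₀ ℂ

/-- `z |n⟩ = √(n)_q |n - 1⟩` (this is `0` for `n = 0`). -/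
def zOp (q : ℝ) : Module.End ℂ OscSpace :=
  Finsupp.linearCombination ℂ fun n : ℕ =>
    Finsupp.single (n - 1) ((Real.sqrt (qNum q n) : ℝ) : ℂ)

/-- `z* |n⟩ = √(n + 1)_q |n + 1⟩`. -/
def zStar (q : ℝ) : Module.End ℂ OscSpace :=
  Finsupp.linearCombination ℂ fun n : ℕ =>
    Finsupp.single (n + 1) ((Real.sqrt (qNum q (n + 1)) : ℝ) : ℂ)

/-- The function `g(ζ)` of the diagonal operator `ζ = 1 - (1 - q) z* z`, for which
`ζ |n⟩ = q^n |n⟩` (see `zeta_eq`). -/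
def zetaFun (q : ℝ) (g : ℝ → ℂ) : Module.End ℂ OscSpace :=
  Finsupp.linearCombination ℂ fun n : ℕ => Finsupp.single n (g (q ^ n))

/-- `f^λ_j(ζ) = q^{j²/4} (iλ)^j / (j)_q! Φ^q(ζ⁻¹, q^{j+1}; q^{j+1} λ² ζ)` for `j ≥ 0`. -/
def fFun (q lam : ℝ) (j : ℕ) (ζ : ℝ) : ℂ :=
  ((q ^ ((j : ℝ) ^ 2 / 4) : ℝ) : ℂ) * (Complex.I * (lam : ℂ)) ^ j / ((qFac q j : ℝ) : ℂ) *
    ((qKummer q ζ⁻¹ (q ^ (j + 1)) (q ^ (j + 1) * lam ^ 2 * ζ) : ℝ) : ℂ)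

/-- `D^λ_j = f^λ_j(ζ) z^j` for `j ≥ 0` and `D^λ_j = z*^{-j} f^λ_{-j}(ζ)` for `j ≤ 0`. -/
def DOp (q lam : ℝ) (j : ℤ) : Module.End ℂ OscSpace :=
  if 0 ≤ j then zetaFun q (fFun q lam j.toNat) * zOp q ^ j.toNat
  else zStar q ^ (-j).toNat * zetaFun q (fFun q lam (-j).toNat)

/-- The matrix element `(D^λ_j)_{mn} = ⟨m| D^λ_j |n⟩`. -/
def DMat (q lam : ℝ) (j : ℤ) (m n : ℕ) : ℂ := DOp q lam j (Finsupp.single n 1) m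

/-! ### The representation space of `B`, `B*`, `A`, with basis `|j⟩` -/

/-- The span of the basis `|j⟩`, `j ∈ ℤ`. -/
abbrev GrpSpace : Type := ℤ →₀ ℂ

/-- `B |j⟩ = q^{j/2} |j - 1⟩`. -/
def BOp (q : ℝ) : Module.End ℂ GrpSpace :=
  Finsupp.linearCombination ℂ fun j : ℤ =>
    Finsupp.single (j - 1) ((q ^ ((j : ℝ) / 2) : ℝ) : ℂ)

/-- `B* |j⟩ = q^{(j+1)/2} |j + 1⟩`. -/
def BStar (q : ℝ) : Module.End ℂ GrpSpace :=
  Finsupp.linearCombination ℂ fun j : ℤ =>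
    Finsupp.single (j + 1) ((q ^ (((j : ℝ) + 1) / 2) : ℝ) : ℂ)

/-- `A |j⟩ = |j - 2⟩`, an invertible operator with `A* = A⁻¹`. -/
def AOp : (Module.End ℂ GrpSpace)ˣ where
  val := Finsupp.linearCombination ℂ fun j : ℤ => Finsupp.single (j - 2) (1 : ℂ)
  inv := Finsupp.linearCombination ℂ fun j : ℤ => Finsupp.single (j + 2) (1 : ℂ)
  val_inv := by
    ext j : 2
    simp
  inv_val := by
    ext j : 2
    simp

/-- The function `g(η)` of the positive diagonal operator `η` with `η² = B* B`, for which
`η |j⟩ = q^{j/2} |j⟩` (see `eta_sq`). -/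
def etaFun (q : ℝ) (g : ℝ → ℝ) : Module.End ℂ GrpSpace :=
  Finsupp.linearCombination ℂ fun j : ℤ =>
    Finsupp.single j ((g (q ^ ((j : ℝ) / 2)) : ℝ) : ℂ)

/-- The matrix elements `t^λ_{ij}` of the irreducible representations of `E_q(2)`. -/
def tOp (q lam : ℝ) (i j : ℤ) : Module.End ℂ GrpSpace :=
  if j ≤ i then
    (((q ^ (((i : ℝ) ^ 2 - (j : ℝ) ^ 2) / 4) / qFac q (i - j).toNat : ℝ)) : ℂ) •
      (((Complex.I * (lam : ℂ)) • BOp q) ^ (i - j).toNat * ↑(AOp ^ j) *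
        etaFun q fun η => qKummer q 0 (q ^ (1 + i - j)) ((q - 1) * q ^ (1 - j) * (lam * η) ^ 2))
  else
    (((q ^ (((i : ℝ) ^ 2 - (j : ℝ) ^ 2) / 4) / qFac q (j - i).toNat : ℝ)) : ℂ) •
      (↑(AOp ^ j) * ((Complex.I * (lam : ℂ)) • BStar q) ^ (j - i).toNat *
        etaFun q fun η => qKummer q 0 (q ^ (1 + j - i)) ((q - 1) * q ^ (1 - i) * (lam * η) ^ 2))

/-! ### The operator `U` on the span of `|n, j⟩ = |n⟩ ⊗ |j⟩` -/

/-- The map `v ↦ |n⟩ ⊗ v`. -/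
def ket (n : ℕ) : GrpSpace →ₗ[ℂ] OscSpace ⊗[ℂ] GrpSpace :=
  TensorProduct.mk ℂ OscSpace GrpSpace (Finsupp.single n 1)

/-- The partial matrix element `u ⊗ v ↦ ⟨m|u⟩ v`. -/
def bra (m : ℕ) : OscSpace ⊗[ℂ] GrpSpace →ₗ[ℂ] GrpSpace :=
  TensorProduct.lid ℂ GrpSpace ∘ₗ TensorProduct.map (Finsupp.lapply m) LinearMap.id

/-- `δ(z*) = B* + A* z*`. -/
def deltaZStar (q : ℝ) : Module.End ℂ (OscSpace ⊗[ℂ] GrpSpace) :=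
  TensorProduct.map LinearMap.id (BStar q) +
    TensorProduct.map (zStar q) (↑(AOp⁻¹) : Module.End ℂ GrpSpace)

/-- `A* B z*`. -/
def ABz (q : ℝ) : Module.End ℂ (OscSpace ⊗[ℂ] GrpSpace) :=
  TensorProduct.map (zStar q) ((↑(AOp⁻¹) : Module.End ℂ GrpSpace) * BOp q)

/-- The operator `U_{mn} = ⟨m| δ(z*)^n e_q^{-A* B z*} |0⟩ √(e_q^{-B* B} / (n)_q!)`, whose matrix
elements are `⟨i| U_{mn} |j⟩ = ⟨m, i| U |n, j⟩`. The factor `e_q^{-A* B z*}` is expanded in its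
power series; only the terms with `k ≤ m` contribute to `⟨m|`, see `UOp_eq_sum`. -/
def UOp (q : ℝ) (m n : ℕ) : Module.End ℂ GrpSpace :=
  (∑ᶠ k : ℕ, (((-1) ^ k / qFac q k : ℝ) : ℂ) •
      (bra m ∘ₗ (deltaZStar q ^ n * ABz q ^ k) ∘ₗ ket 0)) *
    etaFun q fun η => Real.sqrt (qExp q (-η ^ 2) / qFac q n)

/-- `Φ_{mn}(η) = √((n)_q!/(m)_q!) √(e_q^{-η²}) / (n-m)_q! Φ^q(q^{-m}, q^{1+n-m}; q^{n+1} η²)`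
for `m ≤ n`. -/
def PhiFun (q : ℝ) (m n : ℕ) (η : ℝ) : ℝ :=
  Real.sqrt (qFac q n / qFac q m) * (Real.sqrt (qExp q (-η ^ 2)) / qFac q (n - m)) *
    qKummer q (q ^ m)⁻¹ (q ^ (1 + (n - m))) (q ^ (n + 1) * η ^ 2)

/-! ### The Hilbert space in which the sums converge -/

/-- The inclusion of the span of the basis `|j⟩` into the Hilbert space `ℓ²(ℤ)`. -/
def toL2 (v : GrpSpace) : lp (fun _ : ℤ => ℂ) 2 :=
  ∑ j ∈ v.support, lp.single 2 j (v j)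

/-! ### Checks of the definitions -/

theorem toL2_apply (v : GrpSpace) (i : ℤ) : (toL2 v : ∀ _ : ℤ, ℂ) i = v i := by
  classical
  simp only [toL2, lp.coeFn_sum, Finset.sum_apply, lp.single_apply]
  by_cases h : i ∈ v.support
  · rw [Finset.sum_eq_single i]
    · simp
    · intro b _ hb
      simp [hb.symm]
    · simp [h]
  · rw [Finset.sum_eq_zero, eq_comm]
    · simpa using h
    · intro b hb
      have : i ≠ b := fun e => h (e ▸ hb)
      simp [this]

theorem eta_sq {q : ℝ} : BStar q * BOp q = etaFun q fun η => η ^ 2 := by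
  refine Finsupp.lhom_ext' fun j => LinearMap.ext_ring ?_
  have h : ((((j - 1 : ℤ) : ℝ) + 1) / 2) = (j : ℝ) / 2 := by push_cast; ring
  simp only [BStar, BOp, etaFun, LinearMap.comp_apply, Module.End.mul_apply,
    Finsupp.lsingle_apply, Finsupp.linearCombination_single, Finsupp.smul_single, one_smul, h,
    sub_add_cancel, smul_eq_mul]
  push_cast
  rw [sq]

theorem zeta_eq {q : ℝ} (hq0 : 0 < q) (hq1 : q < 1) :
    1 - ((1 - q : ℝ) : ℂ) • (zStar q * zOp q) = zetaFun q fun ζ => (ζ : ℂ) := by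
  have h1 : (1 - q) ≠ 0 := by linarith
  refine Finsupp.lhom_ext' fun n => LinearMap.ext_ring ?_
  rcases n with _ | n
  · simp [zStar, zOp, zetaFun, qNum]
  · have h0 : 0 ≤ qNum q (n + 1) :=
      div_nonneg (sub_nonneg.2 (pow_le_one₀ hq0.le hq1.le)) (by linarith)
    have h2 : (1 - q) * (Real.sqrt (qNum q (n + 1)) * Real.sqrt (qNum q (n + 1))) =
        1 - q ^ (n + 1) := by
      rw [Real.mul_self_sqrt h0, qNum]
      field_simp
    have h4 : ((1 - q : ℝ) : ℂ) * (((Real.sqrt (qNum q (n + 1)) : ℝ) : ℂ) *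
        ((Real.sqrt (qNum q (n + 1)) : ℝ) : ℂ)) = 1 - ((q ^ (n + 1) : ℝ) : ℂ) := by
      exact_mod_cast h2
    simp only [zStar, zOp, zetaFun, LinearMap.comp_apply, LinearMap.sub_apply,
      LinearMap.smul_apply, Module.End.mul_apply, Module.End.one_apply,
      Finsupp.lsingle_apply, Finsupp.linearCombination_single, Finsupp.smul_single, one_smul,
      add_tsub_cancel_right, smul_eq_mul, ← Finsupp.single_sub, h4]
    rw [sub_sub_cancel]

theorem zStar_apply (q : ℝ) (u : OscSpace) (m : ℕ) :
    zStar q u m = if m = 0 then 0 else ((Real.sqrt (qNum q m) : ℝ) : ℂ) * u (m - 1) := by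
  classical
  induction u using Finsupp.induction_linear with
  | zero => simp
  | add f g hf hg =>
    rw [map_add, Finsupp.add_apply, hf, hg, Finsupp.add_apply]
    split_ifs <;> ring
  | single n c =>
    rcases m with _ | m
    · simp [zStar]
    · by_cases h : n = m
      · subst h
        simp [zStar, mul_comm]
      · simp [zStar, h]

theorem bra_tmul (m : ℕ) (u : OscSpace) (v : GrpSpace) : bra m (u ⊗ₜ[ℂ] v) = u m • v := by
  simp [bra]

theorem bra_deltaZStar (q : ℝ) (m : ℕ) (x : OscSpace ⊗[ℂ] GrpSpace) :
    bra m (deltaZStar q x) = BStar q (bra m x) +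
      (if m = 0 then 0 else ((Real.sqrt (qNum q m) : ℝ) : ℂ) •
        (↑(AOp⁻¹) : Module.End ℂ GrpSpace) (bra (m - 1) x)) := by
  induction x using TensorProduct.induction_on with
  | zero => simp
  | add a b ha hb =>
    rw [map_add, map_add, ha, hb]
    split_ifs
    · simp
    · simp only [map_add, smul_add]
      abel
  | tmul u v =>
    simp only [deltaZStar, LinearMap.add_apply, TensorProduct.map_tmul, map_add, bra_tmul,
      zStar_apply, LinearMap.id_apply, map_smul]
    split_ifs <;> simp [smul_smul]

theorem bra_ABz (q : ℝ) (m : ℕ) (x : OscSpace ⊗[ℂ] GrpSpace) :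
    bra m (ABz q x) = if m = 0 then 0 else ((Real.sqrt (qNum q m) : ℝ) : ℂ) •
        (↑(AOp⁻¹) : Module.End ℂ GrpSpace) (BOp q (bra (m - 1) x)) := by
  induction x using TensorProduct.induction_on with
  | zero => simp
  | add a b ha hb =>
    rw [map_add, map_add, ha, hb]
    split_ifs
    · simp
    · simp only [map_add, smul_add]
  | tmul u v =>
    simp only [ABz, TensorProduct.map_tmul, bra_tmul, zStar_apply, map_smul,
      Module.End.mul_apply]
    split_ifs <;> simp [smul_smul]

theorem bra_eq_zero (q : ℝ) (n : ℕ) {m k : ℕ} (h : m < k) (x : OscSpace ⊗[ℂ] GrpSpace) :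
    bra m ((deltaZStar q ^ n) ((ABz q ^ k) x)) = 0 := by
  induction n generalizing m with
  | zero =>
    simp only [pow_zero, Module.End.one_apply]
    induction k generalizing m with
    | zero => omega
    | succ k ih =>
      rw [pow_succ', Module.End.mul_apply, bra_ABz]
      split_ifs with hm
      · rfl
      · rw [ih (by omega)]; simp
  | succ n ih =>
    rw [pow_succ', Module.End.mul_apply, bra_deltaZStar, ih h]
    split_ifs with hm
    · simp
    · rw [ih (by omega)]; simp

theorem UOp_eq_sum (q : ℝ) (m n : ℕ) :
    UOp q m n =
      (∑ k ∈ Finset.range (m + 1), (((-1) ^ k / qFac q k : ℝ) : ℂ) •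
        (bra m ∘ₗ (deltaZStar q ^ n * ABz q ^ k) ∘ₗ ket 0)) *
      etaFun q fun η => Real.sqrt (qExp q (-η ^ 2) / qFac q n) := by
  rw [UOp, finsum_eq_sum_of_support_subset]
  intro k hk
  by_contra hk'
  refine hk ?_
  have h : m < k := by simpa using hk'
  have h0 : bra m ∘ₗ (deltaZStar q ^ n * ABz q ^ k) ∘ₗ ket 0 = 0 :=
    LinearMap.ext fun v => bra_eq_zero q n h _
  simp only [h0, smul_zero]

theorem hasSum_qExp {q x : ℝ} (hq0 : 0 < q) (hq1 : q < 1) (hx : |x| < 1 / (1 - q)) :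
    HasSum (fun k : ℕ => x ^ k / qFac q k) (qExp q x) := by
  have h1 : 0 < 1 - q := by linarith
  have hnum : ∀ k, 0 < qNum q (k + 1) := fun k =>
    div_pos (sub_pos.2 (pow_lt_one₀ hq0.le hq1 (by omega))) h1
  have hfac : ∀ k, 0 < qFac q k := fun k => Finset.prod_pos fun i _ => hnum i
  have hsucc : ∀ k, qFac q (k + 1) = qFac q k * qNum q (k + 1) := fun k =>
    Finset.prod_range_succ _ _
  have hqk : Filter.Tendsto (fun k : ℕ => q ^ k) Filter.atTop (nhds 0) :=
    tendsto_pow_atTop_nhds_zero_of_lt_one hq0.le hq1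
  -- summability
  have hsum : ∀ y : ℝ, |y| < 1 / (1 - q) → Summable fun k : ℕ => y ^ k / qFac q k := by
    intro y hy
    have hy1 : |y| * (1 - q) < 1 := (lt_div_iff₀ h1).1 hy
    obtain ⟨r, hr, hr1⟩ := exists_between hy1
    have ht : Filter.Tendsto (fun k : ℕ => |y| / qNum q (k + 1)) Filter.atTop
        (nhds (|y| * (1 - q))) := by
      have h2 : Filter.Tendsto (fun k : ℕ => |y| * (1 - q) / (1 - q ^ (k + 1))) Filter.atTop
          (nhds (|y| * (1 - q) / (1 - 0))) :=
        tendsto_const_nhds.div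
          (tendsto_const_nhds.sub (hqk.comp (Filter.tendsto_add_atTop_nat 1))) (by norm_num)
      rw [sub_zero, div_one] at h2
      refine h2.congr fun k => ?_
      rw [qNum, div_div_eq_mul_div]
    refine summable_of_ratio_norm_eventually_le hr1 ?_
    filter_upwards [ht.eventually (gt_mem_nhds hr)] with k hk
    rw [hsucc, pow_succ, mul_div_mul_comm, norm_mul, mul_comm]
    refine mul_le_mul_of_nonneg_right ?_ (norm_nonneg _)
    rw [norm_div, Real.norm_eq_abs, Real.norm_of_nonneg (hnum k).le]
    exact hk.le
  set F : ℝ → ℝ := fun y => ∑' k : ℕ, y ^ k / qFac q k with hF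
  -- the functional equation
  have hfun : ∀ y : ℝ, |y| < 1 / (1 - q) → F (q * y) = (1 - (1 - q) * y) * F y := by
    intro y hy
    have hqy : |q * y| < 1 / (1 - q) := by
      rw [abs_mul, abs_of_pos hq0]
      nlinarith [abs_nonneg y]
    have e1 : F y - F (q * y) = ∑' k : ℕ, (y ^ k / qFac q k - (q * y) ^ k / qFac q k) :=
      ((hsum y hy).tsum_sub (hsum _ hqy)).symm
    have e2 : ∑' k : ℕ, (y ^ k / qFac q k - (q * y) ^ k / qFac q k) =
        ∑' k : ℕ, ((1 - q) * y) * (y ^ k / qFac q k) := by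
      rw [((hsum y hy).sub (hsum _ hqy)).tsum_eq_zero_add]
      simp only [pow_zero, sub_self, zero_add]
      refine tsum_congr fun k => ?_
      have h3 := (hfac k).ne'
      have h4 := (hnum k).ne'
      have h5 : qNum q (k + 1) * (1 - q) = 1 - q ^ (k + 1) := div_mul_cancel₀ _ h1.ne'
      rw [hsucc, mul_pow, ← sub_div, div_eq_iff (mul_ne_zero h3 h4)]
      field_simp
      linear_combination (-(y ^ (k + 1))) * h5
    rw [e2, tsum_mul_left] at e1
    have e3 : F y - F (q * y) = (1 - q) * y * F y := e1
    linear_combination -e3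
  have hqN : ∀ N : ℕ, |q ^ N * x| < 1 / (1 - q) := fun N => by
    rw [abs_mul, abs_of_pos (pow_pos hq0 N)]
    exact lt_of_le_of_lt
      (mul_le_of_le_one_left (abs_nonneg x) (pow_le_one₀ hq0.le hq1.le)) hx
  have hiter : ∀ N : ℕ,
      F (q ^ N * x) = (∏ k ∈ Finset.range N, (1 - (1 - q) * q ^ k * x)) * F x := by
    intro N
    induction N with
    | zero => simp
    | succ N ih =>
      rw [pow_succ', mul_assoc, hfun _ (hqN N), ih, Finset.prod_range_succ]
      ring
  -- passage to the limit
  have hF0 : Filter.Tendsto (fun N : ℕ => F (q ^ N * x)) Filter.atTop (nhds 1) := by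
    have h6 : Filter.Tendsto (fun N : ℕ => F (q ^ N * x)) Filter.atTop
        (nhds (∑' k : ℕ, (0 : ℝ) ^ k / qFac q k)) := by
      refine tendsto_tsum_of_dominated_convergence (hsum |x| (by rwa [abs_abs])) ?_ ?_
      · intro k
        have h7 : Filter.Tendsto (fun N : ℕ => q ^ N * x) Filter.atTop (nhds 0) := by
          simpa using hqk.mul_const x
        exact (h7.pow k).div_const _
      · refine Filter.Eventually.of_forall fun N k => ?_
        rw [norm_div, norm_pow, Real.norm_eq_abs, Real.norm_of_nonneg (hfac k).le]
        refine div_le_div_of_nonneg_right (pow_le_pow_left₀ (abs_nonneg _) ?_ k) (hfac k).le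
        rw [abs_mul, abs_of_pos (pow_pos hq0 N)]
        exact mul_le_of_le_one_left (abs_nonneg x) (pow_le_one₀ hq0.le hq1.le)
    have h8 : ∑' k : ℕ, (0 : ℝ) ^ k / qFac q k = 1 := by
      rw [tsum_eq_single 0 fun k hk => by simp [hk]]
      simp [qFac]
    rwa [h8] at h6
  have hmul : Multipliable fun k : ℕ => 1 - (1 - q) * q ^ k * x := by
    have h9 : Summable fun k : ℕ => -((1 - q) * q ^ k * x) :=
      (((summable_geometric_of_lt_one hq0.le hq1).mul_left (1 - q)).mul_right x).neg
    simpa [sub_eq_add_neg] using Real.multipliable_one_add_of_summable h9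
  have hlim := (hmul.tendsto_prod_tprod_nat).mul_const (F x)
  have hone : (∏' k : ℕ, (1 - (1 - q) * q ^ k * x)) * F x = 1 :=
    tendsto_nhds_unique (hlim.congr fun N => (hiter N).symm) hF0
  have hval : F x = qExp q x := by
    rw [qExp]
    exact eq_inv_of_mul_eq_one_right hone
  rw [← hval]
  exact (hsum x hx).hasSum

end QEuclid

end

noncomputable section

namespace QEuclid

/-! ### q-integers and inverse q-factorials -/

/-! The mechanism is that of a q-oscillator: `δ(z) = B + A z` and `δ(z*) = B* + A* z*` satisfy `δ(z)
δ(z*) = q δ(z*) δ(z) + 1`, and `δ(z)` kills `e_q^{-A*Bz*}|0⟩`. Up to square roots, `U_{mn}|l⟩` is a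
scalar `coefU q l n m` times `|l+m+n⟩`. On these scalars `δ(z*)` acts as the recurrence defining
`coefU`, and `δ(z)` as `coefU_lowering`.

For (i), the q-Pascal rule solves the recurrence by a finite sum (`coefU_eq_sum`), which is matched
term by term with the terminating Kummer series (`qKummer_inv_pow`).

For (ii), the matrix elements of `D^λ_j` are those of the normally ordered series `∑_a q^{(j+2a)²/4}
(iλ)^{j+2a} z*^a z^{j+a} / ((a)_q! (j+a)_q!)` (`DMat_eq_sum`), and `t^λ_{jk}` has a similar
expansion in an index `r` (`tOp_single`). In the product of the two, the power of `iλ` is `2M + j`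
with `M = a + r`. At fixed `M` put `b = M + j`. The sum over `s` is then the q-binomial expansion of
`δ(z)^b` (`sum_lowering`), and the remaining sum over `a` is that of `δ(z*)^M` (`sum_raising`).
Together they turn `n` into `n - b + M = n - j`, and what is left over `M` is the expansion of
`(D^λ_j)_{n-j,n}`.

Exchanging the sums over `s` and `M` is legitimate because Gaussian factors in both indices dominate
all other growth (`summable_seriesTerm`). For fixed `l` all terms are multiples of one basis vector,
so convergence in `ℓ²(ℤ)` is scalar convergence.

The convention `1/(z)_q! = 0` for `z < 0` keeps the identities uniform in the signs of `n - m`, `s -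
m` and `j`. -/

/-- The q-number `(z)_q` of an integer. -/
def qInt (q : ℝ) (z : ℤ) : ℝ := (1 - q ^ z) / (1 - q)

/-- The inverse `1 / (z)_q!` of the q-factorial, equal to `0` at the negative integers. -/
def invFac (q : ℝ) (z : ℤ) : ℝ := if z < 0 then 0 else (qFac q z.toNat)⁻¹

theorem qInt_natCast (q : ℝ) (n : ℕ) : qInt q n = qNum q n := by
  simp [qInt, qNum]

theorem qNum_zero (q : ℝ) : qNum q 0 = 0 := by simp [qNum]

theorem qFac_zero (q : ℝ) : qFac q 0 = 1 := by simp [qFac]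

theorem qFac_succ (q : ℝ) (n : ℕ) : qFac q (n + 1) = qFac q n * qNum q (n + 1) :=
  Finset.prod_range_succ _ _

theorem invFac_natCast (q : ℝ) (n : ℕ) : invFac q n = (qFac q n)⁻¹ := by
  simp [invFac]

theorem invFac_of_neg {q : ℝ} {z : ℤ} (hz : z < 0) : invFac q z = 0 := by
  simp [invFac, hz]

section

variable {q : ℝ} (hq0 : 0 < q) (hq1 : q < 1)

include hq0 hq1

theorem one_le_qNum_succ (n : ℕ) : 1 ≤ qNum q (n + 1) := by
  rw [qNum, one_le_div (by linarith)]
  have : q ^ (n + 1) ≤ q ^ 1 := pow_le_pow_of_le_one hq0.le hq1.le (by omega)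
  linarith [pow_one q]

theorem one_le_qFac (n : ℕ) : 1 ≤ qFac q n := by
  induction n with
  | zero => simp [qFac]
  | succ n ih =>
    rw [qFac_succ]
    exact one_le_mul_of_one_le_of_one_le ih (one_le_qNum_succ hq0 hq1 n)

theorem qFac_pos (n : ℕ) : 0 < qFac q n := one_pos.trans_le (one_le_qFac hq0 hq1 n)

theorem qFac_le (n : ℕ) : qFac q n ≤ ((1 - q)⁻¹) ^ n := by
  have h1 : 0 < 1 - q := by linarith
  induction n with
  | zero => simp [qFac]
  | succ n ih =>
    rw [qFac_succ, pow_succ]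
    refine mul_le_mul ih ?_ (zero_le_one.trans (one_le_qNum_succ hq0 hq1 n)) (by positivity)
    rw [qNum, div_eq_mul_inv]
    exact mul_le_of_le_one_left (by positivity) (by linarith [pow_pos hq0 (n + 1)])

theorem invFac_nonneg (z : ℤ) : 0 ≤ invFac q z := by
  rw [invFac]
  split_ifs
  · exact le_rfl
  · exact inv_nonneg.2 (qFac_pos hq0 hq1 _).le

theorem invFac_le_one (z : ℤ) : invFac q z ≤ 1 := by
  rw [invFac]
  split_ifs
  · exact zero_le_one
  · exact inv_le_one_of_one_le₀ (one_le_qFac hq0 hq1 _)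

theorem abs_invFac_le_one (z : ℤ) : |invFac q z| ≤ 1 := by
  rw [abs_of_nonneg (invFac_nonneg hq0 hq1 z)]
  exact invFac_le_one hq0 hq1 z

theorem qInt_mul_invFac (z : ℤ) : qInt q z * invFac q z = invFac q (z - 1) := by
  rcases lt_trichotomy z 0 with h | h | h
  · rw [invFac_of_neg h, invFac_of_neg (by omega), mul_zero]
  · subst h
    rw [invFac_of_neg (show (0 : ℤ) - 1 < 0 by omega)]
    simp [qInt]
  · obtain ⟨n, rfl⟩ : ∃ n : ℕ, z = ((n + 1 : ℕ) : ℤ) := ⟨z.toNat - 1, by omega⟩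
    rw [qInt_natCast, invFac_natCast, show ((n + 1 : ℕ) : ℤ) - 1 = (n : ℤ) by push_cast; ring,
      invFac_natCast, qFac_succ, mul_inv]
    have := one_le_qNum_succ hq0 hq1 n
    field_simp

theorem qFac_mul_invFac (n : ℕ) : qFac q n * invFac q n = 1 := by
  rw [invFac_natCast, mul_inv_cancel₀ (qFac_pos hq0 hq1 n).ne']

theorem qInt_add (x y : ℤ) : qInt q (x + y) = q ^ x * qInt q y + qInt q x := by
  have h1 : (1 - q) ≠ 0 := by linarith
  rw [qInt, qInt, qInt, zpow_add₀ hq0.ne']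
  field_simp
  ring

/-- The q-Pascal rule. -/
theorem qInt_mul_invFac_mul_invFac (x y : ℤ) :
    qInt q (x + y) * (invFac q x * invFac q y) =
      q ^ x * (invFac q x * invFac q (y - 1)) + invFac q (x - 1) * invFac q y := by
  rw [qInt_add hq0 hq1, ← qInt_mul_invFac hq0 hq1 x, ← qInt_mul_invFac hq0 hq1 y]
  ring

end

/-- The bookkeeping of a Pascal rule: one part loses its top term, the other its bottom term and is
then shifted. -/
theorem sum_range_add_two {M : Type*} [AddCommMonoid M] {f g h : ℕ → M} {b : ℕ}
    (hfg : ∀ c, h c = f c + g c) (hf : f (b + 1) = 0) (hg : g 0 = 0) :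
    ∑ c ∈ Finset.range (b + 2), h c =
      ∑ c ∈ Finset.range (b + 1), f c + ∑ c ∈ Finset.range (b + 1), g (c + 1) := by
  rw [Finset.sum_congr rfl fun c _ => hfg c, Finset.sum_add_distrib,
    Finset.sum_range_succ f, hf, add_zero, Finset.sum_range_succ' g, hg, add_zero]

/-! ### The coefficients of `U` -/

/-- The coefficients for which
`U_{mn} |l⟩ = √(e_q^{-q^l}) √((m)_q! / (n)_q!) (coefU q l n m) |l + m + n⟩`. -/
def coefU (q : ℝ) (l : ℤ) : ℕ → ℤ → ℝ
  -- Only the term of degree `m` of the q-exponential reaches `⟨m|`. The next clause is `B* + A*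
  -- z*`; its factor `√(m)_q` is absorbed in the normalisation.
  | 0, m => (-1) ^ m.toNat * invFac q m * q ^ (((m : ℝ) * l + m * (m - 1) / 2) / 2)
  | n + 1, m => q ^ (((l : ℝ) + m + n + 1) / 2) * coefU q l n m + coefU q l n (m - 1)

theorem coefU_of_neg {q : ℝ} {l : ℤ} (n : ℕ) {m : ℤ} (hm : m < 0) : coefU q l n m = 0 := by
  induction n generalizing m with
  | zero => simp [coefU, invFac_of_neg hm]
  | succ n ih => rw [coefU, ih hm, ih (by omega)]; simp

/-- The action of `δ(z) = B + A z` in coordinates. The case `n = 0` says that it kills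
`e_q^{-A*Bz*}|0⟩`, and the induction step is the relation `δ(z) δ(z*) = q δ(z*) δ(z) + 1`. -/
theorem coefU_lowering {q : ℝ} (hq0 : 0 < q) (hq1 : q < 1) (l : ℤ) (n : ℕ) (m : ℤ) :
    q ^ (((l : ℝ) + m + n) / 2) * coefU q l n m + qInt q (m + 1) * coefU q l n (m + 1) =
      qNum q n * coefU q l (n - 1) m := by
  induction n generalizing m with
  | zero =>
    rw [qNum_zero, zero_mul]
    -- At `m = -1` the second coefficient need not vanish, but its factor `(m+1)_q` does.
    rcases lt_trichotomy m (-1) with h | h | h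
    · rw [coefU_of_neg _ (by omega), coefU_of_neg _ (by omega)]; simp
    · subst h
      rw [coefU_of_neg _ (by omega)]; simp [qInt]
    · have h1 := qInt_mul_invFac hq0 hq1 (m + 1)
      rw [add_sub_cancel_right] at h1
      have h2 : (m + 1).toNat = m.toNat + 1 := by omega
      have h3 : q ^ ((((m + 1 : ℤ) : ℝ) * l + ((m + 1 : ℤ) : ℝ) * (((m + 1 : ℤ) : ℝ) - 1) / 2) / 2)
          = q ^ (((l : ℝ) + m + (0 : ℕ)) / 2) * q ^ (((m : ℝ) * l + m * (m - 1) / 2) / 2) := by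
        rw [← Real.rpow_add hq0]
        congr 1
        push_cast
        ring
      rw [coefU, coefU, h2, h3, pow_succ, ← h1]
      ring
  | succ n ih =>
    rw [Nat.add_sub_cancel, coefU, coefU, add_sub_cancel_right]
    have ih1 := ih m
    have ih2 := ih (m - 1)
    rw [sub_add_cancel] at ih2
    have e1 : q ^ (((l : ℝ) + m + (n + 1 : ℕ)) / 2) = q ^ (1 / 2 : ℝ) * q ^ (((l : ℝ) + m + n) / 2) := by
      rw [← Real.rpow_add hq0]; congr 1; push_cast; ring
    have e2 : q ^ (((l : ℝ) + m + n + 1) / 2) = q ^ (1 / 2 : ℝ) * q ^ (((l : ℝ) + m + n) / 2) := by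
      rw [← Real.rpow_add hq0]; congr 1; ring
    have e3 : q ^ (((l : ℝ) + (m + 1 : ℤ) + n + 1) / 2) =
        q ^ (1 : ℝ) * q ^ (((l : ℝ) + m + n) / 2) := by
      rw [← Real.rpow_add hq0]; congr 1; push_cast; ring
    have e4 : q ^ (((l : ℝ) + m + n) / 2) =
        q ^ (1 / 2 : ℝ) * q ^ (((l : ℝ) + (m - 1 : ℤ) + n) / 2) := by
      rw [← Real.rpow_add hq0]; congr 1; push_cast; ring
    have e5 : q ^ (1 / 2 : ℝ) * q ^ (1 / 2 : ℝ) = q := by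
      rw [← Real.rpow_add hq0]; norm_num
    have e6 : qInt q (m + 1) = q * qInt q m + 1 := by
      have h1 : (1 - q) ≠ 0 := by linarith
      rw [add_comm, qInt_add hq0 hq1, zpow_one]
      simp [qInt, h1]
    have e7 : qNum q (n + 1) = q * qNum q n + 1 := by
      have h1 : (1 - q) ≠ 0 := by linarith
      rw [qNum, qNum]
      field_simp
      ring
    -- The defining recurrence read backwards. At `n = 0` the truncated `n - 1` is harmless because
    -- `(0)_q = 0`.
    have e8 : qNum q n * (q ^ (((l : ℝ) + m + n) / 2) * coefU q l (n - 1) m +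
        coefU q l (n - 1) (m - 1)) = qNum q n * coefU q l n m := by
      rcases n with _ | n
      · simp [qNum]
      · congr 1
        rw [Nat.add_sub_cancel, coefU]
        congr 3
        push_cast
        ring
    rw [e1, e2, e3, Real.rpow_one, e7, ← sub_eq_zero]
    set X := q ^ (((l : ℝ) + m + n) / 2)
    set Y := q ^ (((l : ℝ) + (m - 1 : ℤ) + n) / 2)
    set h := q ^ (1 / 2 : ℝ)
    linear_combination q * X * ih1 + q * ih2 + q * e8 + X ^ 2 * coefU q l n m * e5 +
      coefU q l n m * e6 + h * coefU q l n (m - 1) * e4 + Y * coefU q l n (m - 1) * e5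

/-- Iterated raising: the q-binomial expansion of `δ(z*)^M`. -/
theorem sum_raising {q : ℝ} (hq0 : 0 < q) (hq1 : q < 1) (l : ℤ) (n M : ℕ) (m : ℤ) :
    ∑ a ∈ Finset.range (M + 1), invFac q a * invFac q (M - a) *
      q ^ ((((M : ℝ) - a) * (l + m - a + n) + (M - a) * (M - a + 1) / 2) / 2) *
        coefU q l n (m - a) = invFac q M * coefU q l (n + M) m := by
  induction M generalizing m with
  | zero => simp [invFac, qFac_zero]
  | succ M ih =>
    have h0 : qInt q (M + 1) ≠ 0 := by
      have := one_le_qNum_succ hq0 hq1 M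
      rw [← qInt_natCast] at this
      push_cast at this
      linarith
    have h1 : invFac q M = qInt q (M + 1) * invFac q (M + 1 : ℕ) := by
      push_cast
      rw [qInt_mul_invFac hq0 hq1, add_sub_cancel_right]
    -- The factor `(M+1)_q` is what q-Pascal splits; its two parts match the two terms of the
    -- recurrence for `coefU` at `n + M + 1`.
    refine mul_left_cancel₀ h0 ?_
    rw [← add_assoc, coefU, Finset.mul_sum, ← mul_assoc, ← h1, mul_add, ← ih (m - 1),
      mul_left_comm, ← ih m, Finset.mul_sum]
    rw [sum_range_add_two
      (f := fun a : ℕ => q ^ (((l : ℝ) + m + (n + M : ℕ) + 1) / 2) *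
        (invFac q a * invFac q (M - a) *
          q ^ ((((M : ℝ) - a) * (l + m - a + n) + (M - a) * (M - a + 1) / 2) / 2) *
            coefU q l n (m - a)))
      (g := fun a : ℕ => invFac q (a - 1) * invFac q (M + 1 - a) *
          q ^ ((((M : ℝ) + 1 - a) * (l + m - a + n) + (M + 1 - a) * (M + 1 - a + 1) / 2) / 2) *
            coefU q l n (m - a))]
    · refine congrArg _ (Finset.sum_congr rfl fun a _ => ?_)
      push_cast
      rw [add_sub_cancel_right, sub_sub m 1 (a : ℤ), add_comm (1 : ℤ), add_sub_add_right_eq_sub]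
      congr 3
      ring
    · intro a
      have h2 := qInt_mul_invFac_mul_invFac hq0 hq1 (a : ℤ) (M + 1 - a)
      rw [add_sub_cancel, sub_right_comm, add_sub_cancel_right] at h2
      have h3 : q ^ (((l : ℝ) + m + (n + M : ℕ) + 1) / 2) *
          q ^ ((((M : ℝ) - a) * (l + m - a + n) + (M - a) * (M - a + 1) / 2) / 2) =
          q ^ (a : ℤ) *
          q ^ ((((M : ℝ) + 1 - a) * (l + m - a + n) + (M + 1 - a) * (M + 1 - a + 1) / 2) / 2) := by
        rw [← Real.rpow_intCast, ← Real.rpow_add hq0, ← Real.rpow_add hq0]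
        congr 1
        push_cast
        ring
      push_cast at h3 ⊢
      linear_combination q ^ ((((M : ℝ) + 1 - a) * (l + m - a + n) +
        (M + 1 - a) * (M + 1 - a + 1) / 2) / 2) * coefU q l n (m - a) * h2 -
        invFac q a * invFac q (M - a) * coefU q l n (m - a) * h3
    · simp [invFac_of_neg]
    · simp [invFac_of_neg]

/-- Iterated lowering: the q-binomial expansion of `δ(z)^b`. -/
theorem sum_lowering {q : ℝ} (hq0 : 0 < q) (hq1 : q < 1) (l : ℤ) (n b m : ℕ) :
    ∑ c ∈ Finset.range (b + 1), invFac q c * invFac q (b - c) * qFac q (m + c) *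
      q ^ ((((b : ℝ) - c) * (l + n + m - c) - (b - c) * (b - c - 1) / 2) / 2) *
        coefU q l n (m + c) =
      invFac q b * qFac q m * (qFac q n * invFac q (n - b)) * coefU q l (n - b) m := by
  induction b generalizing m with
  | zero => simp [invFac, qFac_zero, (qFac_pos hq0 hq1 n).ne']
  | succ b ih =>
    have h0 : qInt q (b + 1) ≠ 0 := by
      have := one_le_qNum_succ hq0 hq1 b
      rw [← qInt_natCast] at this
      push_cast at this
      linarith
    have h1 : invFac q b = qInt q (b + 1) * invFac q (b + 1 : ℕ) := by
      push_cast
      rw [qInt_mul_invFac hq0 hq1, add_sub_cancel_right]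
    refine mul_left_cancel₀ h0 ?_
    have h4 : invFac q b * qFac q m * (qFac q n * invFac q (n - (b + 1 : ℕ))) *
        coefU q l (n - (b + 1)) m =
        q ^ (((l : ℝ) + m + n - b) / 2) *
          (invFac q b * qFac q m * (qFac q n * invFac q (n - b)) * coefU q l (n - b) m) +
        invFac q b * qFac q (m + 1) * (qFac q n * invFac q (n - b)) *
          coefU q l (n - b) (m + 1 : ℕ) := by
      -- For `b > n` both sides vanish through the inverse factorials, so the truncated `n - b` has
      -- no effect.
      rcases lt_or_ge n b with h | h
      · rw [invFac_of_neg (show (n : ℤ) - b < 0 by omega),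
          invFac_of_neg (show (n : ℤ) - (b + 1 : ℕ) < 0 by omega)]
        simp
      · have h5 := coefU_lowering hq0 hq1 l (n - b) m
        have h6 := qInt_mul_invFac hq0 hq1 (n - b)
        rw [← Nat.cast_sub h, qInt_natCast, Nat.cast_sub h] at h6
        rw [← Nat.sub_sub, qFac_succ, ← qInt_natCast q (m + 1)]
        rw [Nat.cast_sub h, ← add_sub_assoc] at h5
        push_cast at h5 ⊢
        rw [← sub_sub, ← h6]
        linear_combination -invFac q b * qFac q m * qFac q n * invFac q (n - b) * h5
    have h8 : qInt q (b + 1) * (invFac q (b + 1 : ℕ) * qFac q m *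
        (qFac q n * invFac q (n - (b + 1 : ℕ))) * coefU q l (n - (b + 1)) m) =
        invFac q b * qFac q m * (qFac q n * invFac q (n - (b + 1 : ℕ))) *
          coefU q l (n - (b + 1)) m := by
      rw [h1]
      ring
    rw [Finset.mul_sum, h8, h4, ← ih m, ← ih (m + 1), Finset.mul_sum]
    rw [sum_range_add_two
      (f := fun c : ℕ => q ^ (((l : ℝ) + m + n - b) / 2) *
        (invFac q c * invFac q (b - c) * qFac q (m + c) *
          q ^ ((((b : ℝ) - c) * (l + n + m - c) - (b - c) * (b - c - 1) / 2) / 2) *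
            coefU q l n (m + c)))
      (g := fun c : ℕ => q ^ ((b : ℤ) + 1 - c) * (invFac q (c - 1) * invFac q (b + 1 - c)) *
        qFac q (m + c) *
          q ^ ((((b : ℝ) + 1 - c) * (l + n + m - c) - (b + 1 - c) * (b + 1 - c - 1) / 2) / 2) *
            coefU q l n (m + c))]
    · refine congrArg _ (Finset.sum_congr rfl fun c _ => ?_)
      have h7 : q ^ ((((b : ℝ) - c) * (l + n + (m + 1 : ℕ) - c) - (b - c) * (b - c - 1) / 2) / 2) =
          q ^ ((b : ℤ) + 1 - (c + 1 : ℕ)) *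
          q ^ ((((b : ℝ) + 1 - (c + 1 : ℕ)) * (l + n + m - (c + 1 : ℕ)) -
            (b + 1 - (c + 1 : ℕ)) * (b + 1 - (c + 1 : ℕ) - 1) / 2) / 2) := by
        rw [← Real.rpow_intCast, ← Real.rpow_add hq0]
        congr 1
        push_cast
        ring
      rw [h7, show m + (c + 1) = m + 1 + c by ring]
      push_cast
      rw [add_sub_cancel_right, add_sub_add_right_eq_sub, add_right_comm (m : ℤ), ← add_assoc]
      ring
    · intro c
      -- Compared with `sum_raising` the arguments are swapped: here the power of `q` must accompany
      -- the shifted part.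
      have h2 := qInt_mul_invFac_mul_invFac hq0 hq1 (b + 1 - c : ℤ) c
      rw [sub_add_cancel, sub_right_comm, add_sub_cancel_right] at h2
      have h3 : q ^ (((l : ℝ) + m + n - b) / 2) *
          q ^ ((((b : ℝ) - c) * (l + n + m - c) - (b - c) * (b - c - 1) / 2) / 2) =
          q ^ ((((b : ℝ) + 1 - c) * (l + n + m - c) - (b + 1 - c) * (b + 1 - c - 1) / 2) / 2) := by
        rw [← Real.rpow_add hq0]
        congr 1
        ring
      push_cast
      linear_combination qFac q (m + c) * q ^ ((((b : ℝ) + 1 - c) * (l + n + m - c) -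
        (b + 1 - c) * (b + 1 - c - 1) / 2) / 2) * coefU q l n (m + c) * h2 -
        invFac q c * invFac q (b - c) * qFac q (m + c) * coefU q l n (m + c) * h3
    · simp [invFac_of_neg]
    · simp [invFac_of_neg]

/-- The coefficients of `U` as finite sums. -/
theorem coefU_eq_sum {q : ℝ} (hq0 : 0 < q) (hq1 : q < 1) (l : ℤ) (n K : ℕ) {m : ℤ}
    (hm : m < K) :
    coefU q l n m = ∑ k ∈ Finset.range K, (-1) ^ k * invFac q k * qFac q n * invFac q (m - k) *
      invFac q (n - m + k) * q ^ (((k : ℝ) * l + k * (k - 1) / 2) / 2 +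
        (((n : ℝ) - m + k) * (l + k) + (n - m + k) * (n - m + k + 1) / 2) / 2) := by
  induction n generalizing m with
  | zero =>
    rcases lt_or_ge m 0 with h | h
    · rw [coefU_of_neg _ h, Finset.sum_eq_zero]
      intro k _
      rw [invFac_of_neg (show m - k < 0 by omega)]
      simp
    · lift m to ℕ using h
      -- At `n = 0` the factors `1/(m-k)_q!` and `1/(k-m)_q!` leave only `k = m`.
      rw [Finset.sum_eq_single m]
      · simp [coefU, qFac_zero, invFac]
      · intro k _ hk
        rcases lt_or_gt_of_ne hk with h | h
        · rw [invFac_of_neg (show ((0 : ℕ) : ℤ) - m + k < 0 by omega)]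
          simp
        · rw [invFac_of_neg (show (m : ℤ) - k < 0 by omega)]
          simp
      · intro h
        exact absurd (Finset.mem_range.2 (by exact_mod_cast hm)) h
  | succ n ih =>
    -- As any `K > m` is allowed, both coefficients expand over the same range. They then merge
    -- termwise by q-Pascal at `m - k` and `n + 1 - m + k`, whose sum does not involve `k`.
    rw [coefU, ih hm, ih (show m - 1 < K by omega), Finset.mul_sum, ← Finset.sum_add_distrib]
    refine Finset.sum_congr rfl fun k _ => ?_
    have h2 := qInt_mul_invFac_mul_invFac hq0 hq1 (m - k) (n + 1 - m + k)
    rw [show m - k + (n + 1 - m + k : ℤ) = ((n + 1 : ℕ) : ℤ) by push_cast; ring,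
      show (n + 1 - m + k : ℤ) - 1 = n - m + k by ring, qInt_natCast] at h2
    have h3 : q ^ (((l : ℝ) + m + n + 1) / 2) * q ^ (((k : ℝ) * l + k * (k - 1) / 2) / 2 +
        (((n : ℝ) - m + k) * (l + k) + (n - m + k) * (n - m + k + 1) / 2) / 2) =
        q ^ (m - k : ℤ) * q ^ (((k : ℝ) * l + k * (k - 1) / 2) / 2 +
        (((n : ℝ) + 1 - m + k) * (l + k) + (n + 1 - m + k) * (n + 1 - m + k + 1) / 2) / 2) := by
      rw [← Real.rpow_intCast, ← Real.rpow_add hq0, ← Real.rpow_add hq0]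
      congr 1
      push_cast
      ring
    have h4 : (n : ℝ) - (m - 1 : ℤ) + k = n + 1 - m + k := by push_cast; ring
    have h5 : (n : ℤ) - (m - 1) + k = n + 1 - m + k := by ring
    rw [h4, h5, qFac_succ, show m - 1 - (k : ℤ) = m - k - 1 by ring]
    push_cast
    linear_combination (-1) ^ k * invFac q k * qFac q n * invFac q (m - k) *
      invFac q (n - m + k) * h3 - (-1) ^ k * invFac q k * qFac q n *
      q ^ (((k : ℝ) * l + k * (k - 1) / 2) / 2 +
        (((n : ℝ) + 1 - m + k) * (l + k) + (n + 1 - m + k) * (n + 1 - m + k + 1) / 2) / 2) * h2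

/-! ### The q-Kummer series -/

theorem rpow_mul_pred_div_two (q : ℝ) (k : ℕ) :
    q ^ (k * (k - 1) / 2) = q ^ ((k : ℝ) * (k - 1) / 2) := by
  rw [← Nat.cast_choose_two ℝ k, Real.rpow_natCast, Nat.choose_two_right]

section

variable {q : ℝ} (hq0 : 0 < q) (hq1 : q < 1)

include hq0 hq1

theorem summable_rpow_quadratic {α : ℝ} (hα : 0 < α) (β γ : ℝ) :
    Summable fun s : ℕ => q ^ (α * (s : ℝ) ^ 2 + β * s + γ) := by
  refine Summable.of_norm_bounded_eventually_nat (g := fun s => q ^ s)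
    (summable_geometric_of_lt_one hq0.le hq1) ?_
  -- Beyond this bound `α s² + β s + γ ≥ s`, which gives the comparison with `q^s`.
  obtain ⟨N, hN⟩ := exists_nat_ge ((|β - 1| + |γ|) / α)
  filter_upwards [Filter.eventually_ge_atTop (max N 1)] with s hs
  have hs1 : (1 : ℝ) ≤ s := by exact_mod_cast (le_max_right _ _).trans hs
  have hs2 : (|β - 1| + |γ|) / α ≤ s := hN.trans (by exact_mod_cast (le_max_left _ _).trans hs)
  rw [div_le_iff₀ hα] at hs2
  rw [Real.norm_of_nonneg (Real.rpow_nonneg hq0.le _), ← Real.rpow_natCast q s]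
  refine Real.rpow_le_rpow_of_exponent_ge hq0 hq1.le ?_
  have h1 := mul_le_mul_of_nonneg_right hs2 (zero_le_one.trans hs1)
  have h2 := mul_le_mul_of_nonneg_right (neg_abs_le (β - 1)) (zero_le_one.trans hs1)
  have h3 := mul_le_mul_of_nonneg_left hs1 (abs_nonneg γ)
  have h4 := neg_abs_le γ
  nlinarith

/-- Geometric growth only changes the linear term of the exponent, since `R = q^{log_q R}`. -/
theorem summable_pow_mul_rpow_quadratic {R : ℝ} (hR : 0 < R) {α : ℝ} (hα : 0 < α) (β γ : ℝ) :
    Summable fun s : ℕ => R ^ s * q ^ (α * (s : ℝ) ^ 2 + β * s + γ) := by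
  refine (summable_rpow_quadratic hq0 hq1 hα (Real.logb q R + β) γ).congr fun s => ?_
  have h : R ^ s = q ^ (Real.logb q R * s) := by
    rw [Real.rpow_mul hq0.le, Real.rpow_logb hq0 hq1.ne hR, Real.rpow_natCast]
  rw [h, ← Real.rpow_add hq0]
  congr 1
  ring

omit hq0 in
theorem qPoch_self (k : ℕ) : qPoch q q k = (1 - q) ^ k * qFac q k := by
  have h1 : (1 - q) ≠ 0 := by linarith
  induction k with
  | zero => simp [qPoch, qFac]
  | succ k ih =>
    rw [qPoch, Finset.prod_range_succ, ← qPoch, ih, qFac_succ, qNum]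
    field_simp
    ring

omit hq0 in
theorem qPoch_pow_succ (d k : ℕ) :
    qPoch (q ^ (1 + d)) q k * qFac q d = (1 - q) ^ k * qFac q (d + k) := by
  have h1 : (1 - q) ≠ 0 := by linarith
  induction k with
  | zero => simp [qPoch]
  | succ k ih =>
    rw [qPoch, Finset.prod_range_succ, ← qPoch, mul_right_comm, ih, ← add_assoc, qFac_succ, qNum]
    field_simp
    ring

/-- Each factor is reversed by `1 - q^{i-m} = -q^{i-m} (1 - q^{m-i})`; the inverse factorial records
the vanishing for `k > m`. -/
theorem qPoch_inv_pow (m k : ℕ) :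
    qPoch (q ^ m)⁻¹ q k = (-1) ^ k * q ^ ((k : ℝ) * (k - 1) / 2 - m * k) * (1 - q) ^ k *
      (qFac q m * invFac q (m - k)) := by
  have h1 : (1 - q) ≠ 0 := by linarith
  induction k with
  | zero => simp [qPoch, qFac_mul_invFac hq0 hq1]
  | succ k ih =>
    have h2 := qInt_mul_invFac hq0 hq1 (m - k)
    have h3 : q ^ (((k + 1 : ℕ) : ℝ) * ((k + 1 : ℕ) - 1) / 2 - m * (k + 1 : ℕ)) =
        q ^ ((k : ℝ) * (k - 1) / 2 - m * k) * q ^ (k - m : ℤ) := by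
      rw [← Real.rpow_intCast, ← Real.rpow_add hq0]
      congr 1
      push_cast
      ring
    have h4 : (q ^ m)⁻¹ * q ^ k = q ^ (k - m : ℤ) := by
      rw [zpow_sub₀ hq0.ne', zpow_natCast, zpow_natCast]
      field_simp
    have h5 : 1 - q ^ (k - m : ℤ) = - q ^ (k - m : ℤ) * (1 - q) * qInt q (m - k) := by
      have h6 : q ^ (k - m : ℤ) * q ^ (m - k : ℤ) = 1 := by
        rw [← zpow_add₀ hq0.ne']; simp
      rw [qInt]
      field_simp
      linear_combination -h6
    rw [qPoch, Finset.prod_range_succ, ← qPoch, ih, h3, h4, h5]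
    push_cast
    rw [← sub_sub, ← h2]
    ring

/-- The powers of `1 - q` in the argument cancel those of the two shifted factorials and leave a
sign. The factor `q^{r(r-1)/2}` gives convergence for every `y`. -/
theorem hasSum_qKummer_zero (d : ℕ) (y : ℝ) :
    HasSum (fun r : ℕ => (-1) ^ r * q ^ ((r : ℝ) * (r - 1) / 2) * qFac q d * invFac q r *
      invFac q (d + r) * y ^ r) (qKummer q 0 (q ^ (1 + d)) ((q - 1) * y)) := by
  have h1 : (1 - q) ≠ 0 := by linarith
  have hs : Summable fun r : ℕ => (-1) ^ r * q ^ ((r : ℝ) * (r - 1) / 2) * qFac q d * invFac q r *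
      invFac q (d + r) * y ^ r := by
    refine Summable.of_norm_bounded (g := fun r : ℕ => qFac q d * ((|y| + 1) ^ r *
      q ^ ((1 / 2) * (r : ℝ) ^ 2 + (-1 / 2) * r + 0)))
      ((summable_pow_mul_rpow_quadratic hq0 hq1 (by positivity) (by norm_num) _ _).mul_left _) ?_
    intro r
    have e1 : (1 / 2) * (r : ℝ) ^ 2 + (-1 / 2) * r + 0 = (r : ℝ) * (r - 1) / 2 := by ring
    have hf := (qFac_pos hq0 hq1 d).le
    have hx := Real.rpow_nonneg hq0.le ((r : ℝ) * (r - 1) / 2)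
    rw [e1, norm_mul, norm_mul, norm_mul, norm_mul, norm_mul, norm_pow, norm_pow, norm_neg,
      norm_one, one_pow, one_mul, Real.norm_of_nonneg hf, Real.norm_of_nonneg hx, Real.norm_eq_abs,
      Real.norm_eq_abs, Real.norm_eq_abs]
    have i1 := abs_invFac_le_one hq0 hq1 r
    have i2 := abs_invFac_le_one hq0 hq1 (d + r)
    have i3 : |y| ^ r ≤ (|y| + 1) ^ r := by gcongr; linarith
    calc q ^ ((r : ℝ) * (r - 1) / 2) * qFac q d * |invFac q r| * |invFac q (d + r)| * |y| ^ r
        ≤ q ^ ((r : ℝ) * (r - 1) / 2) * qFac q d * 1 * 1 * (|y| + 1) ^ r := by gcongr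
      _ = _ := by ring
  convert hs.hasSum using 1
  rw [qKummer]
  refine tsum_congr fun r => ?_
  have h2 := qPoch_self hq1 r
  have h3 := qPoch_pow_succ hq1 d r
  have h4 : qPoch 0 q r = 1 := by simp [qPoch]
  have h5 := (qFac_pos hq0 hq1 d).ne'
  have h6 := (qFac_pos hq0 hq1 r).ne'
  have h7 := (qFac_pos hq0 hq1 (d + r)).ne'
  rw [← eq_div_iff h5] at h3
  rw [h2, h3, h4, rpow_mul_pred_div_two, ← Nat.cast_add, invFac_natCast, invFac_natCast,
    show (1 - q) * ((q - 1) * y) = (-1) * (1 - q) ^ 2 * y by ring, mul_pow, mul_pow]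
  field_simp
  rw [pow_right_comm]

/-- This terminating case serves both `U` and `D`, since `ζ⁻¹` takes the value `(q^n)⁻¹` on `|n⟩`.
-/
theorem qKummer_inv_pow (m d : ℕ) (x : ℝ) :
    qKummer q (q ^ m)⁻¹ (q ^ (1 + d)) x = ∑ k ∈ Finset.range (m + 1),
      (-1) ^ k * q ^ ((k : ℝ) * (k - 1) - m * k) * qFac q m * qFac q d * invFac q (m - k) *
        invFac q k * invFac q (d + k) * x ^ k := by
  have h1 : (1 - q) ≠ 0 := by linarith
  have h0 : ∀ r : ℕ, q ^ (r * (r - 1) / 2) * qPoch (q ^ m)⁻¹ q r /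
      (qPoch q q r * qPoch (q ^ (1 + d)) q r) * ((1 - q) * x) ^ r =
      (-1) ^ r * q ^ ((r : ℝ) * (r - 1) - m * r) * qFac q m * qFac q d * invFac q (m - r) *
        invFac q r * invFac q (d + r) * x ^ r := by
    intro r
    have h2 := qPoch_self hq1 r
    have h3 := qPoch_pow_succ hq1 d r
    have h5 := (qFac_pos hq0 hq1 d).ne'
    have h6 := (qFac_pos hq0 hq1 r).ne'
    have h7 := (qFac_pos hq0 hq1 (d + r)).ne'
    have h8 : q ^ ((r : ℝ) * (r - 1) - m * r) =
        q ^ ((r : ℝ) * (r - 1) / 2) * q ^ ((r : ℝ) * (r - 1) / 2 - m * r) := by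
      rw [← Real.rpow_add hq0]
      congr 1
      ring
    rw [← eq_div_iff h5] at h3
    rw [h2, h3, qPoch_inv_pow hq0 hq1, rpow_mul_pred_div_two, ← Nat.cast_add,
      invFac_natCast q r, invFac_natCast q (d + r), mul_pow, h8]
    field_simp
  rw [qKummer, tsum_congr h0, tsum_eq_sum]
  intro r hr
  rw [Finset.mem_range, not_lt] at hr
  rw [invFac_of_neg (show (m : ℤ) - r < 0 by omega)]
  simp

end

/-! ### The operators on basis vectors -/

theorem etaFun_single (q : ℝ) (g : ℝ → ℝ) (l : ℤ) (c : ℂ) :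
    etaFun q g (Finsupp.single l c) =
      Finsupp.single l (c * ((g (q ^ ((l : ℝ) / 2)) : ℝ) : ℂ)) := by
  simp [etaFun, Finsupp.linearCombination_single, Finsupp.smul_single]

theorem AOp_zpow_single (z l : ℤ) (c : ℂ) :
    (↑(AOp ^ z) : Module.End ℂ GrpSpace) (Finsupp.single l c) = Finsupp.single (l - 2 * z) c := by
  have h1 : ∀ l c, (↑AOp : Module.End ℂ GrpSpace) (Finsupp.single l c) =
      Finsupp.single (l - 2) c := by
    intro l c
    simp [AOp]
  have h2 : ∀ l c, (↑(AOp⁻¹) : Module.End ℂ GrpSpace) (Finsupp.single l c) =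
      Finsupp.single (l + 2) c := by
    intro l c
    simp [AOp]
  induction z generalizing l with
  | zero => simp
  | succ n ih =>
    rw [zpow_add_one, Units.val_mul, Module.End.mul_apply, h1, ih]
    congr 1
    ring
  | pred n ih =>
    rw [zpow_sub_one, Units.val_mul, Module.End.mul_apply, h2, ih]
    congr 1
    ring

theorem AOp_inv_single (l : ℤ) (c : ℂ) :
    (↑(AOp⁻¹) : Module.End ℂ GrpSpace) (Finsupp.single l c) = Finsupp.single (l + 2) c := by
  simp [AOp]

theorem BOp_single (q : ℝ) (l : ℤ) (c : ℂ) :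
    BOp q (Finsupp.single l c) = Finsupp.single (l - 1) (c * ((q ^ ((l : ℝ) / 2) : ℝ) : ℂ)) := by
  simp [BOp, Finsupp.linearCombination_single, Finsupp.smul_single]

theorem BStar_single (q : ℝ) (l : ℤ) (c : ℂ) :
    BStar q (Finsupp.single l c) =
      Finsupp.single (l + 1) (c * ((q ^ (((l : ℝ) + 1) / 2) : ℝ) : ℂ)) := by
  simp [BStar, Finsupp.linearCombination_single, Finsupp.smul_single]

theorem BOp_pow_single {q : ℝ} (hq0 : 0 < q) (d : ℕ) (l : ℤ) (c : ℂ) :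
    (BOp q ^ d) (Finsupp.single l c) = Finsupp.single (l - d)
      (c * ((q ^ (((d : ℝ) * l - d * (d - 1) / 2) / 2) : ℝ) : ℂ)) := by
  induction d with
  | zero => simp
  | succ d ih =>
    rw [pow_succ', Module.End.mul_apply, ih, BOp_single, mul_assoc, ← Complex.ofReal_mul,
      ← Real.rpow_add hq0]
    push_cast
    ring_nf

theorem BStar_pow_single {q : ℝ} (hq0 : 0 < q) (d : ℕ) (l : ℤ) (c : ℂ) :
    (BStar q ^ d) (Finsupp.single l c) = Finsupp.single (l + d)
      (c * ((q ^ (((d : ℝ) * l + d * (d + 1) / 2) / 2) : ℝ) : ℂ)) := by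
  induction d with
  | zero => simp
  | succ d ih =>
    rw [pow_succ', Module.End.mul_apply, ih, BStar_single, mul_assoc, ← Complex.ofReal_mul,
      ← Real.rpow_add hq0]
    push_cast
    ring_nf

theorem zetaFun_single (q : ℝ) (g : ℝ → ℂ) (n : ℕ) (c : ℂ) :
    zetaFun q g (Finsupp.single n c) = Finsupp.single n (c * g (q ^ n)) := by
  simp [zetaFun, Finsupp.linearCombination_single, Finsupp.smul_single]

theorem zOp_pow_single {q : ℝ} (hq0 : 0 < q) (hq1 : q < 1) (d n : ℕ) (c : ℂ) :
    (zOp q ^ d) (Finsupp.single (n + d) c) =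
      Finsupp.single n (c * ((Real.sqrt (qFac q (n + d)) / Real.sqrt (qFac q n) : ℝ) : ℂ)) := by
  induction d generalizing c with
  | zero => simp [(Real.sqrt_pos.2 (qFac_pos hq0 hq1 n)).ne']
  | succ d ih =>
    have h : zOp q (Finsupp.single (n + (d + 1)) c) =
        Finsupp.single (n + d) (c * ((Real.sqrt (qNum q (n + d + 1)) : ℝ) : ℂ)) := by
      simp [zOp, Finsupp.linearCombination_single, Finsupp.smul_single, ← add_assoc]
    rw [pow_succ, Module.End.mul_apply, h, ih, ← add_assoc, qFac_succ,
      Real.sqrt_mul (qFac_pos hq0 hq1 _).le]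
    push_cast
    ring_nf

theorem zStar_pow_single {q : ℝ} (hq0 : 0 < q) (hq1 : q < 1) (d n : ℕ) (c : ℂ) :
    (zStar q ^ d) (Finsupp.single n c) =
      Finsupp.single (n + d)
        (c * ((Real.sqrt (qFac q (n + d)) / Real.sqrt (qFac q n) : ℝ) : ℂ)) := by
  induction d with
  | zero => simp [(Real.sqrt_pos.2 (qFac_pos hq0 hq1 n)).ne']
  | succ d ih =>
    have h : ∀ c, zStar q (Finsupp.single (n + d) c) =
        Finsupp.single (n + (d + 1)) (c * ((Real.sqrt (qNum q (n + d + 1)) : ℝ) : ℂ)) := by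
      simp [zStar, Finsupp.linearCombination_single, Finsupp.smul_single, ← add_assoc]
    rw [pow_succ', Module.End.mul_apply, ih, h, ← add_assoc, qFac_succ,
      Real.sqrt_mul (qFac_pos hq0 hq1 _).le]
    push_cast
    ring_nf

/-! ### The operators `U_{mn}`: action on basis vectors and Kummer closed forms -/

/-- The operators `U_{mn}` on basis vectors. -/
theorem UOp_single {q : ℝ} (hq0 : 0 < q) (hq1 : q < 1) (m n : ℕ) (l : ℤ) :
    UOp q m n (Finsupp.single l 1) = Finsupp.single (l + m + n)
      ((Real.sqrt (qExp q (-(q ^ ((l : ℝ) / 2)) ^ 2)) *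
        (Real.sqrt (qFac q m) / Real.sqrt (qFac q n)) * coefU q l n m : ℝ) : ℂ) := by
  have h0 : ∀ k m : ℕ, bra m ((ABz q ^ k) (ket 0 (Finsupp.single l 1))) =
      if k = m then Finsupp.single (l + m) ((Real.sqrt (qFac q m) *
        q ^ (((m : ℝ) * l + m * (m - 1) / 2) / 2) : ℝ) : ℂ) else 0 := by
    intro k
    induction k with
    | zero =>
      intro m
      rw [pow_zero, Module.End.one_apply, ket, TensorProduct.mk_apply, bra_tmul]
      rcases m with _ | m
      · simp [qFac_zero]
      · simp
    | succ k ih =>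
      intro m
      rw [pow_succ', Module.End.mul_apply, bra_ABz]
      rcases m with _ | m
      · simp
      · rw [if_neg (by omega), Nat.add_sub_cancel, ih]
        by_cases h : k = m
        · rw [if_pos h, if_pos (by omega), BOp_single, AOp_inv_single, Finsupp.smul_single,
            smul_eq_mul, qFac_succ, Real.sqrt_mul (qFac_pos hq0 hq1 _).le, ← Complex.ofReal_mul,
            mul_assoc (Real.sqrt (qFac q m)), ← Real.rpow_add hq0, ← Complex.ofReal_mul]
          push_cast
          ring_nf
        · rw [if_neg h, if_neg (by omega)]
          simp
  -- The cutoff `K` is independent of `m`, because the induction on `n` uses `m` and `m - 1` with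
  -- the same sum.
  have h1 : ∀ K n m : ℕ, m < K → ∑ k ∈ Finset.range K, (((-1) ^ k / qFac q k : ℝ) : ℂ) •
      bra m ((deltaZStar q ^ n) ((ABz q ^ k) (ket 0 (Finsupp.single l 1)))) =
      Finsupp.single (l + m + n) ((Real.sqrt (qFac q m) * coefU q l n m : ℝ) : ℂ) := by
    intro K n
    induction n with
    | zero =>
      intro m hm
      rw [Finset.sum_eq_single m]
      · rw [pow_zero, Module.End.one_apply, h0, if_pos rfl, Finsupp.smul_single, smul_eq_mul,
          ← Complex.ofReal_mul, coefU, invFac_natCast]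
        simp only [Nat.cast_zero, add_zero, Int.toNat_natCast, Int.cast_natCast]
        congr 2
        ring
      · intro k _ hk
        rw [pow_zero, Module.End.one_apply, h0, if_neg hk, smul_zero]
      · intro h
        exact absurd (Finset.mem_range.2 hm) h
    | succ n ih =>
      intro m hm
      have e : ∀ k : ℕ, (((-1) ^ k / qFac q k : ℝ) : ℂ) •
          bra m ((deltaZStar q ^ (n + 1)) ((ABz q ^ k) (ket 0 (Finsupp.single l 1)))) =
          BStar q ((((-1) ^ k / qFac q k : ℝ) : ℂ) •
            bra m ((deltaZStar q ^ n) ((ABz q ^ k) (ket 0 (Finsupp.single l 1))))) +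
          if m = 0 then 0 else ((Real.sqrt (qNum q m) : ℝ) : ℂ) •
            (↑(AOp⁻¹) : Module.End ℂ GrpSpace) ((((-1) ^ k / qFac q k : ℝ) : ℂ) •
              bra (m - 1) ((deltaZStar q ^ n) ((ABz q ^ k) (ket 0 (Finsupp.single l 1))))) := by
        intro k
        rw [pow_succ', Module.End.mul_apply, bra_deltaZStar, smul_add, map_smul]
        split_ifs
        · simp
        · rw [map_smul, smul_comm]
      rw [Finset.sum_congr rfl fun k _ => e k, Finset.sum_add_distrib, ← map_sum, ih m hm,
        BStar_single, coefU]
      rcases m with _ | m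
      · rw [coefU_of_neg n (show ((0 : ℕ) : ℤ) - 1 < 0 by omega)]
        simp only [if_true, Finset.sum_const_zero, add_zero, ← Complex.ofReal_mul]
        push_cast
        ring_nf
      · simp only [Nat.add_eq_zero_iff, one_ne_zero, and_false, if_false, Nat.add_sub_cancel]
        rw [← Finset.smul_sum, ← map_sum, ih m (by omega), AOp_inv_single, Finsupp.smul_single,
          qFac_succ, Real.sqrt_mul (qFac_pos hq0 hq1 _).le]
        rw [show l + (m : ℤ) + n + 2 = l + (m + 1 : ℕ) + (n + 1 : ℕ) by push_cast; ring,
          show l + (m + 1 : ℕ) + (n : ℤ) + 1 = l + (m + 1 : ℕ) + (n + 1 : ℕ) by push_cast; ring,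
          ← Finsupp.single_add, smul_eq_mul, ← Complex.ofReal_mul, ← Complex.ofReal_mul,
          ← Complex.ofReal_add, show ((m + 1 : ℕ) : ℤ) - 1 = m by push_cast; ring]
        push_cast
        ring_nf
  rw [UOp_eq_sum, Module.End.mul_apply, etaFun_single, one_mul]
  have h2 : ∀ c : ℂ, (Finsupp.single l c : GrpSpace) = c • Finsupp.single l 1 := by
    intro c; simp
  rw [h2, map_smul, LinearMap.sum_apply]
  simp only [LinearMap.smul_apply, LinearMap.comp_apply, Module.End.mul_apply]
  rw [h1 _ _ _ (Nat.lt_succ_self m), Finsupp.smul_single, smul_eq_mul,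
    ← Complex.ofReal_mul, Real.sqrt_div' _ (qFac_pos hq0 hq1 n).le]
  congr 2
  ring

/-- `U_{mn}` in terms of a q-Kummer function, for `m ≤ n`. -/
theorem UOp_eq_of_le {q : ℝ} (hq0 : 0 < q) (hq1 : q < 1) {m n : ℕ} (h : m ≤ n) :
    UOp q m n = (↑(AOp ^ (-(m : ℤ))) : Module.End ℂ GrpSpace) *
      BStar q ^ (n - m) * etaFun q (PhiFun q m n) := by
  obtain ⟨d, rfl⟩ := Nat.exists_eq_add_of_le h
  refine Finsupp.lhom_ext' fun l => LinearMap.ext_ring ?_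
  rw [LinearMap.comp_apply, LinearMap.comp_apply, Finsupp.lsingle_apply, UOp_single hq0 hq1,
    Module.End.mul_apply, Module.End.mul_apply, etaFun_single, BStar_pow_single hq0,
    AOp_zpow_single, one_mul, Nat.add_sub_cancel_left, ← Complex.ofReal_mul]
  have e1 : l + (m : ℤ) + (m + d : ℕ) = l + (d : ℤ) - 2 * -(m : ℤ) := by push_cast; ring
  rw [e1, PhiFun, Nat.add_sub_cancel_left, qKummer_inv_pow hq0 hq1,
    coefU_eq_sum hq0 hq1 l (m + d) (m + 1) (by push_cast; omega),
    Real.sqrt_div (qFac_pos hq0 hq1 _).le]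
  congr 2
  simp only [Finset.mul_sum, Finset.sum_mul]
  refine Finset.sum_congr rfl fun k _ => ?_
  have e2 : q ^ (((k : ℝ) * l + k * (k - 1) / 2) / 2 +
        ((((m + d : ℕ) : ℝ) - (m : ℤ) + k) * (l + k) +
          ((m + d : ℕ) - (m : ℤ) + k) * ((m + d : ℕ) - (m : ℤ) + k + 1) / 2) / 2) =
      q ^ ((k : ℝ) * (k - 1) - m * k) * (q ^ (m + d + 1) * (q ^ ((l : ℝ) / 2)) ^ 2) ^ k *
        q ^ (((d : ℝ) * l + d * (d + 1) / 2) / 2) := by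
    rw [← Real.rpow_natCast (q ^ ((l : ℝ) / 2)), ← Real.rpow_mul hq0.le, ← Real.rpow_natCast q,
      ← Real.rpow_add hq0, ← Real.rpow_natCast (q ^ _), ← Real.rpow_mul hq0.le,
      ← Real.rpow_add hq0, ← Real.rpow_add hq0]
    congr 1
    push_cast
    ring
  have e3 : ((m + d : ℕ) : ℤ) - m + k = d + k := by push_cast; ring
  rw [e2, e3]
  have h1 := (Real.sqrt_pos.2 (qFac_pos hq0 hq1 m)).ne'
  have h2 := (Real.sqrt_pos.2 (qFac_pos hq0 hq1 (m + d))).ne'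
  have h3 := Real.sq_sqrt (qFac_pos hq0 hq1 m).le
  have h4 := Real.sq_sqrt (qFac_pos hq0 hq1 (m + d)).le
  have h5 := (qFac_pos hq0 hq1 d).ne'
  field_simp
  rw [h3, h4]
  ring

/-- `U_{mn}` in terms of a q-Kummer function, for `n ≤ m`. -/
theorem UOp_eq_of_ge {q : ℝ} (hq0 : 0 < q) (hq1 : q < 1) {m n : ℕ} (h : n ≤ m) :
    UOp q m n = ((q ^ (((m : ℝ) - n) * ((m : ℝ) - n - 1) / 2) : ℝ) : ℂ) •
      ((↑(AOp ^ (-(m : ℤ))) : Module.End ℂ GrpSpace) *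
        (-BOp q) ^ (m - n) * etaFun q (PhiFun q n m)) := by
  obtain ⟨d, rfl⟩ := Nat.exists_eq_add_of_le h
  have e0 : (-BOp q) ^ d = (((-1) ^ d : ℝ) : ℂ) • BOp q ^ d := by
    have e : -BOp q = ((-1 : ℝ) : ℂ) • BOp q := LinearMap.ext fun x => by
      rw [LinearMap.neg_apply, LinearMap.smul_apply, Complex.ofReal_neg, Complex.ofReal_one]
      exact (neg_one_smul ℂ _).symm
    rw [e, Complex.ofReal_pow, smul_pow]
  refine Finsupp.lhom_ext' fun l => LinearMap.ext_ring ?_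
  rw [LinearMap.comp_apply, LinearMap.comp_apply, Finsupp.lsingle_apply, UOp_single hq0 hq1,
    Nat.add_sub_cancel_left, e0, LinearMap.smul_apply,
    Module.End.mul_apply, Module.End.mul_apply, etaFun_single, LinearMap.smul_apply,
    BOp_pow_single hq0, Finsupp.smul_single,
    AOp_zpow_single, one_mul, Finsupp.smul_single, smul_eq_mul, smul_eq_mul,
    ← Complex.ofReal_mul, ← Complex.ofReal_mul, ← Complex.ofReal_mul]
  have e1 : l + ((n + d : ℕ) : ℤ) + n = l - (d : ℤ) - 2 * -((n + d : ℕ) : ℤ) := by push_cast; ring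
  rw [e1, PhiFun, Nat.add_sub_cancel_left, qKummer_inv_pow hq0 hq1,
    coefU_eq_sum hq0 hq1 l n (n + d + 1) (by push_cast; omega),
    Real.sqrt_div (qFac_pos hq0 hq1 _).le]
  congr 2
  -- With `d = m - n`, the factor `1/(n-m+k)_q!` kills the terms `k < d`; shifting by `d` produces
  -- the sign `(-1)^d` and the Kummer sum.
  rw [show n + d + 1 = d + (n + 1) by ring, Finset.sum_range_add, Finset.sum_eq_zero, zero_add]
  · simp only [Finset.mul_sum, Finset.sum_mul]
    refine Finset.sum_congr rfl fun k _ => ?_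
    have e2 : q ^ ((((d + k : ℕ) : ℝ) * l + (d + k : ℕ) * ((d + k : ℕ) - 1) / 2) / 2 +
          (((n : ℝ) - ((n + d : ℕ) : ℤ) + (d + k : ℕ)) * (l + (d + k : ℕ)) +
            (n - ((n + d : ℕ) : ℤ) + (d + k : ℕ)) *
              (n - ((n + d : ℕ) : ℤ) + (d + k : ℕ) + 1) / 2) / 2) =
        q ^ ((k : ℝ) * (k - 1) - n * k) * (q ^ (n + d + 1) * (q ^ ((l : ℝ) / 2)) ^ 2) ^ k *
          q ^ (((d : ℝ) * l - d * (d - 1) / 2) / 2) *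
          q ^ ((((n + d : ℕ) : ℝ) - n) * (((n + d : ℕ) : ℝ) - n - 1) / 2) := by
      rw [← Real.rpow_natCast (q ^ ((l : ℝ) / 2)), ← Real.rpow_mul hq0.le, ← Real.rpow_natCast q,
        ← Real.rpow_add hq0, ← Real.rpow_natCast (q ^ _), ← Real.rpow_mul hq0.le,
        ← Real.rpow_add hq0, ← Real.rpow_add hq0, ← Real.rpow_add hq0]
      congr 1
      push_cast
      ring
    have e3 : (n : ℤ) - (n + d : ℕ) + (d + k : ℕ) = k := by push_cast; ring
    have e4 : ((n + d : ℕ) : ℤ) - (d + k : ℕ) = n - k := by push_cast; ring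
    rw [e2, e3, e4, Nat.cast_add d k, pow_add]
    have h1 := (Real.sqrt_pos.2 (qFac_pos hq0 hq1 n)).ne'
    have h3 := Real.sq_sqrt (qFac_pos hq0 hq1 n).le
    have h5 := (qFac_pos hq0 hq1 d).ne'
    field_simp
    ring
  · intro k hk
    have := Finset.mem_range.1 hk
    rw [invFac_of_neg (show (n : ℤ) - (n + d : ℕ) + k < 0 by push_cast; omega)]
    simp

/-! ### The coefficients of `D` and `t` -/

theorem I_mul_pow_add_two_mul (lam : ℝ) (k a : ℕ) :
    (Complex.I * lam) ^ (k + 2 * a) =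
      (Complex.I * lam) ^ k * (((-1) ^ a * (lam ^ 2) ^ a : ℝ) : ℂ) := by
  rw [pow_add, pow_mul, mul_pow Complex.I _ 2, Complex.I_sq]
  push_cast
  ring

/-- The matrix elements of `D`. -/
theorem DMat_eq_sum {q : ℝ} (hq0 : 0 < q) (hq1 : q < 1) (lam : ℝ) (m s : ℕ) :
    DMat q lam ((s : ℤ) - m) m s = ∑ a ∈ Finset.range (m + 1),
      ((q ^ (((s : ℝ) - m + 2 * a) ^ 2 / 4) * invFac q a * invFac q (s - m + a) *
        invFac q (m - a) * (Real.sqrt (qFac q m) * Real.sqrt (qFac q s)) : ℝ) : ℂ) *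
          (Complex.I * lam) ^ ((s : ℤ) - m + 2 * a).toNat := by
  -- The right side comes from `⟨n| z*^a z^{k+a} |n+k⟩`. The same identity serves both signs of `s -
  -- m`.
  have key : ∀ n k a : ℕ, Real.sqrt (qFac q (n + k)) / Real.sqrt (qFac q n) *
      (q ^ ((k : ℝ) ^ 2 / 4) / qFac q k *
        ((-1) ^ a * q ^ ((a : ℝ) * (a - 1) - n * a) * qFac q n * qFac q k * invFac q (n - a) *
          invFac q a * invFac q (k + a) * (q ^ (k + 1) * lam ^ 2 * q ^ n) ^ a)) =
      q ^ (((k : ℝ) + 2 * a) ^ 2 / 4) * invFac q a * invFac q (k + a) * invFac q (n - a) *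
        (Real.sqrt (qFac q n) * Real.sqrt (qFac q (n + k))) * ((-1) ^ a * (lam ^ 2) ^ a) := by
    intro n k a
    have e1 : q ^ (((k : ℝ) + 2 * a) ^ 2 / 4) = q ^ ((k : ℝ) ^ 2 / 4) *
        q ^ ((a : ℝ) * (a - 1) - n * a) * (q ^ (k + 1 + n)) ^ a := by
      rw [← Real.rpow_natCast q, ← Real.rpow_natCast (q ^ _), ← Real.rpow_mul hq0.le,
        ← Real.rpow_add hq0, ← Real.rpow_add hq0]
      congr 1
      push_cast
      ring
    have h1 := (Real.sqrt_pos.2 (qFac_pos hq0 hq1 n)).ne'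
    have h3 := Real.sq_sqrt (qFac_pos hq0 hq1 n).le
    have h5 := (qFac_pos hq0 hq1 k).ne'
    rw [e1, show q ^ (k + 1) * lam ^ 2 * q ^ n = q ^ (k + 1 + n) * lam ^ 2 by ring, mul_pow]
    field_simp
    rw [h3]
  rcases le_or_gt m s with h | h
  · obtain ⟨k, rfl⟩ := Nat.exists_eq_add_of_le h
    have e1 : (((m + k : ℕ) : ℤ) - m) = k := by push_cast; ring
    have e2 : (((m + k : ℕ) : ℝ) - m) = k := by push_cast; ring
    rw [DMat, DOp, e1, e2, if_pos (by omega), Int.toNat_natCast, Module.End.mul_apply,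
      zOp_pow_single hq0 hq1, zetaFun_single, Finsupp.single_eq_same, one_mul, fFun,
      add_comm k 1, qKummer_inv_pow hq0 hq1, Complex.ofReal_sum, Finset.mul_sum, Finset.mul_sum]
    refine Finset.sum_congr rfl fun a _ => ?_
    rw [show ((k : ℤ) + 2 * a).toNat = k + 2 * a by omega, I_mul_pow_add_two_mul]
    have := congrArg Complex.ofReal (key m k a)
    rw [add_comm k 1] at this
    push_cast at this ⊢
    linear_combination (Complex.I * lam) ^ k * this
  · obtain ⟨k, rfl⟩ := Nat.exists_eq_add_of_le h.le
    have e1 : ((s : ℤ) - (s + k : ℕ)) = -k := by push_cast; ring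
    have e2 : ((s : ℝ) - (s + k : ℕ)) = -k := by push_cast; ring
    rw [DMat, DOp, e1, e2, if_neg (by omega), neg_neg, Int.toNat_natCast, Module.End.mul_apply,
      zetaFun_single, zStar_pow_single hq0 hq1, Finsupp.single_eq_same, one_mul, fFun,
      add_comm k 1, qKummer_inv_pow hq0 hq1, Complex.ofReal_sum, Finset.mul_sum, Finset.sum_mul,
      show s + k + 1 = k + (s + 1) by ring, Finset.sum_range_add _ k]
    -- For `s < m` the first `k = m - s` terms vanish through `1/(s-m+a)_q!`, and the shift by `k`
    -- reduces to `key`.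
    rw [Finset.sum_eq_zero (s := Finset.range k), zero_add]
    · refine Finset.sum_congr rfl fun a _ => ?_
      rw [show (-(k : ℤ) + 2 * (k + a : ℕ)).toNat = k + 2 * a by omega, I_mul_pow_add_two_mul,
        show -(k : ℝ) + 2 * (k + a : ℕ) = k + 2 * a by push_cast; ring,
        show -(k : ℤ) + (k + a : ℕ) = a by push_cast; ring,
        show ((s + k : ℕ) : ℤ) - (k + a : ℕ) = s - a by push_cast; ring, Nat.cast_add k a]
      have := congrArg Complex.ofReal (key s k a)
      rw [add_comm k 1] at this
      push_cast at this ⊢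
      linear_combination (Complex.I * lam) ^ k * this
    · intro a ha
      have := Finset.mem_range.1 ha
      rw [invFac_of_neg (show -(k : ℤ) + a < 0 by omega)]
      simp

theorem ofReal_mul_mul_ofReal_eq {F : ℝ} (hF : F ≠ 0) (P : ℂ) (A E Q u w Z L s : ℝ) :
    ((A * E * Q * Z * u * w : ℝ) : ℂ) * (P * ((s * L : ℝ) : ℂ)) =
      P * ((A / F * E * (s * Q * F * u * w * (L * Z)) : ℝ) : ℂ) := by
  have h : A / F * E * (s * Q * F * u * w * (L * Z)) = A * E * Q * Z * u * w * (s * L) := by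
    field_simp
  rw [h]
  push_cast
  ring

/-- The operators `t_{jk}` on basis vectors. -/
theorem tOp_single {q : ℝ} (hq0 : 0 < q) (hq1 : q < 1) (lam : ℝ) (j k p : ℤ) :
    ∃ τ : ℂ, (∀ c : ℂ, tOp q lam j k (Finsupp.single p c) =
        Finsupp.single (p - j - k) (c * τ)) ∧
      HasSum (fun r : ℕ => ((q ^ (((j : ℝ) ^ 2 - (k : ℝ) ^ 2) / 4 + (j - k) * (p - 2 * k) / 2 -
        (j - k) * (j - k - 1) / 4 + r * (r - 1) / 2 + r * (1 - k + p)) * invFac q r *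
          invFac q (j - k + r) : ℝ) : ℂ) * (Complex.I * lam) ^ (j - k + 2 * r).toNat) τ := by
  rcases le_or_gt k j with h | h
  · obtain ⟨d, rfl⟩ := Int.le.dest h
    have e1 : k + d - k = (d : ℤ) := by ring
    have e2 : 1 + (k + d) - k = ((1 + d : ℕ) : ℤ) := by push_cast; ring
    have e3 : p - (k + d) - k = p - 2 * k - d := by ring
    have e4 : ∀ η : ℝ, (q - 1) * q ^ (1 - k) * (lam * η) ^ 2 =
        (q - 1) * (q ^ (1 - k) * (lam * η) ^ 2) := fun η => by ring
    simp only [tOp, if_pos h, e1, e2, e3, e4, zpow_natCast, Int.toNat_natCast, smul_pow,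
      LinearMap.smul_apply, Module.End.mul_apply, etaFun_single, AOp_zpow_single,
      BOp_pow_single hq0, Finsupp.smul_single, smul_eq_mul]
    refine ⟨(Complex.I * lam) ^ d * ((q ^ ((((k + d : ℤ) : ℝ) ^ 2 - k ^ 2) / 4) / qFac q d *
      q ^ (((d : ℝ) * (p - 2 * k : ℤ) - d * (d - 1) / 2) / 2) *
      qKummer q 0 (q ^ (1 + d)) ((q - 1) * (q ^ (1 - k) * (lam * q ^ ((p : ℝ) / 2)) ^ 2)) : ℝ) : ℂ),
      fun c => congrArg _ ?_, ?_⟩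
    · push_cast
      ring
    · refine (((Complex.hasSum_ofReal.2 ((hasSum_qKummer_zero hq0 hq1 d (q ^ (1 - k) *
        (lam * q ^ ((p : ℝ) / 2)) ^ 2)).mul_left (q ^ ((((k + d : ℤ) : ℝ) ^ 2 - k ^ 2) / 4) /
          qFac q d * q ^ (((d : ℝ) * (p - 2 * k : ℤ) - d * (d - 1) / 2) / 2)))).mul_left
            ((Complex.I * lam) ^ d))).congr_fun fun r => ?_
      have e5 : q ^ ((((k + d : ℤ) : ℝ) ^ 2 - (k : ℝ) ^ 2) / 4 +
          ((k + d : ℤ) - k) * (p - 2 * k) / 2 - ((k + d : ℤ) - k) * ((k + d : ℤ) - k - 1) / 4 +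
          r * (r - 1) / 2 + r * (1 - k + p)) = q ^ ((((k + d : ℤ) : ℝ) ^ 2 - k ^ 2) / 4) *
          q ^ (((d : ℝ) * (p - 2 * k : ℤ) - d * (d - 1) / 2) / 2) *
          q ^ ((r : ℝ) * (r - 1) / 2) * (q ^ (1 - k) * (q ^ ((p : ℝ) / 2)) ^ 2) ^ r := by
        rw [← Real.rpow_natCast (q ^ ((p : ℝ) / 2)), ← Real.rpow_mul hq0.le, ← Real.rpow_intCast q,
          ← Real.rpow_add hq0 ((1 - k : ℤ) : ℝ), ← Real.rpow_natCast (q ^ _), ← Real.rpow_mul hq0.le,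
          ← Real.rpow_add hq0, ← Real.rpow_add hq0, ← Real.rpow_add hq0]
        congr 1
        push_cast
        ring
      rw [e5, show ((d : ℤ) + 2 * r).toNat = d + 2 * r by omega, I_mul_pow_add_two_mul,
        mul_pow lam, mul_left_comm (q ^ (1 - k)), mul_pow (lam ^ 2)]
      exact ofReal_mul_mul_ofReal_eq (qFac_pos hq0 hq1 d).ne' _ _ _ _ _ _ _ _ _
  · obtain ⟨d, rfl⟩ := Int.le.dest h.le
    have e1 : j + d - j = (d : ℤ) := by ring
    have e2 : 1 + (j + d) - j = ((1 + d : ℕ) : ℤ) := by push_cast; ring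
    have e3 : p + d - 2 * (j + d) = p - j - (j + d) := by ring
    have e4 : ∀ η : ℝ, (q - 1) * q ^ (1 - j) * (lam * η) ^ 2 =
        (q - 1) * (q ^ (1 - j) * (lam * η) ^ 2) := fun η => by ring
    simp only [tOp, if_neg h.not_ge, e1, e2, e3, e4, zpow_natCast, Int.toNat_natCast, smul_pow,
      LinearMap.smul_apply, Module.End.mul_apply, etaFun_single, AOp_zpow_single,
      BStar_pow_single hq0, Finsupp.smul_single, smul_eq_mul]
    refine ⟨(Complex.I * lam) ^ d * ((q ^ (((j : ℝ) ^ 2 - ((j + d : ℤ) : ℝ) ^ 2) / 4) / qFac q d *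
      q ^ (((d : ℝ) * p + d * (d + 1) / 2) / 2) *
      qKummer q 0 (q ^ (1 + d)) ((q - 1) * (q ^ (1 - j) * (lam * q ^ ((p : ℝ) / 2)) ^ 2)) : ℝ) : ℂ),
      fun c => ?_, ?_⟩
    · refine congrArg _ ?_
      push_cast
      ring
    · have e6 : (j : ℤ) - (j + d) = -d := by ring
      -- The uniform series really starts at `r = d`, the earlier terms being zero; shifted, it is
      -- the Kummer series of the `B*` branch.
      rw [← Function.Injective.hasSum_iff (add_right_injective d)]
      · refine (((Complex.hasSum_ofReal.2 ((hasSum_qKummer_zero hq0 hq1 d (q ^ (1 - j) *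
          (lam * q ^ ((p : ℝ) / 2)) ^ 2)).mul_left (q ^ (((j : ℝ) ^ 2 - ((j + d : ℤ) : ℝ) ^ 2) / 4) /
            qFac q d * q ^ (((d : ℝ) * p + d * (d + 1) / 2) / 2)))).mul_left
              ((Complex.I * lam) ^ d))).congr_fun fun r => ?_
        have e5 : q ^ (((j : ℝ) ^ 2 - ((j + d : ℤ) : ℝ) ^ 2) / 4 +
            (j - (j + d : ℤ)) * (p - 2 * (j + d : ℤ)) / 2 -
            (j - (j + d : ℤ)) * (j - (j + d : ℤ) - 1) / 4 +
            (d + r : ℕ) * ((d + r : ℕ) - 1) / 2 + (d + r : ℕ) * (1 - (j + d : ℤ) + p)) =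
            q ^ (((j : ℝ) ^ 2 - ((j + d : ℤ) : ℝ) ^ 2) / 4) *
            q ^ (((d : ℝ) * p + d * (d + 1) / 2) / 2) *
            q ^ ((r : ℝ) * (r - 1) / 2) * (q ^ (1 - j) * (q ^ ((p : ℝ) / 2)) ^ 2) ^ r := by
          rw [← Real.rpow_natCast (q ^ ((p : ℝ) / 2)), ← Real.rpow_mul hq0.le,
            ← Real.rpow_intCast q, ← Real.rpow_add hq0 ((1 - j : ℤ) : ℝ), ← Real.rpow_natCast (q ^ _),
            ← Real.rpow_mul hq0.le, ← Real.rpow_add hq0, ← Real.rpow_add hq0, ← Real.rpow_add hq0]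
          congr 1
          push_cast
          ring
        have e7 : -(d : ℤ) + (d + r : ℕ) = r := by push_cast; ring
        simp only [Function.comp_apply]
        rw [e5, e6, e7, show (-(d : ℤ) + 2 * (d + r : ℕ)).toNat = d + 2 * r by omega,
          I_mul_pow_add_two_mul, mul_pow lam, mul_left_comm (q ^ (1 - j)), mul_pow (lam ^ 2),
          Nat.cast_add d r, mul_right_comm _ (invFac q ((d : ℤ) + r)) (invFac q r)]
        exact ofReal_mul_mul_ofReal_eq (qFac_pos hq0 hq1 d).ne' _ _ _ _ _ _ _ _ _
      · intro r hr
        have hr' : r < d := by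
          by_contra h'
          exact hr ⟨r - d, by simp; omega⟩
        rw [e6, invFac_of_neg (show -(d : ℤ) + r < 0 by omega)]
        simp

/-! ### The double series -/

section

variable {q : ℝ} (hq0 : 0 < q) (hq1 : q < 1)

include hq0 hq1

/-- The coefficients of `U_{mn}` grow at most exponentially in `m`. -/
theorem exists_abs_coefU_le (l : ℤ) (n : ℕ) :
    ∃ C R : ℝ, 0 < R ∧ ∀ m : ℕ, |coefU q l n m| ≤ C * R ^ m := by
  set R : ℝ := q ^ (-|(l : ℝ)| / 2) with hR
  have hR1 : 1 ≤ R := Real.one_le_rpow_of_pos_of_le_one_of_nonpos hq0 hq1.le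
    (by linarith [abs_nonneg (l : ℝ)])
  suffices h : ∃ C : ℝ, 0 ≤ C ∧ ∀ m : ℤ, |coefU q l n m| ≤ C * R ^ m.toNat by
    obtain ⟨C, _, hC⟩ := h
    exact ⟨C, R, one_pos.trans_le hR1, fun m => by simpa using hC m⟩
  induction n with
  | zero =>
    refine ⟨1, zero_le_one, fun m => ?_⟩
    rcases lt_or_ge m 0 with h | h
    · rw [coefU_of_neg _ h, abs_zero]
      positivity
    · lift m to ℕ using h
      have h1 : R ^ m = q ^ (-|(l : ℝ)| / 2 * m) := by
        rw [hR, Real.rpow_mul hq0.le, Real.rpow_natCast]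
      rw [coefU, abs_mul, abs_mul, abs_pow, abs_neg, abs_one, one_pow, one_mul, one_mul,
        Int.toNat_natCast, h1, abs_of_nonneg (Real.rpow_nonneg hq0.le _)]
      refine (mul_le_of_le_one_left (Real.rpow_nonneg hq0.le _)
        (abs_invFac_le_one hq0 hq1 _)).trans (Real.rpow_le_rpow_of_exponent_ge hq0 hq1.le ?_)
      have h2 : (0 : ℝ) ≤ (m : ℝ) * (m - 1) := by
        rcases m with _ | m
        · simp
        · push_cast; rw [add_sub_cancel_right]; positivity
      have h3 : (m : ℝ) * (-|(l : ℝ)|) ≤ m * l :=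
        mul_le_mul_of_nonneg_left (neg_abs_le _) (Nat.cast_nonneg m)
      push_cast
      linarith
  | succ n ih =>
    obtain ⟨C, hC0, hC⟩ := ih
    refine ⟨q ^ (((l : ℝ) + n + 1) / 2) * C + C, by positivity, fun m => ?_⟩
    rcases lt_or_ge m 0 with h | h
    · rw [coefU_of_neg _ h, abs_zero]
      positivity
    · rw [coefU, add_mul]
      refine (abs_add_le _ _).trans (add_le_add ?_ ?_)
      · rw [abs_mul, abs_of_nonneg (Real.rpow_nonneg hq0.le _), mul_assoc]
        refine mul_le_mul (Real.rpow_le_rpow_of_exponent_ge hq0 hq1.le ?_) (hC m) (abs_nonneg _)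
          (Real.rpow_nonneg hq0.le _)
        have : (0 : ℝ) ≤ m := by exact_mod_cast h
        linarith
      · refine (hC _).trans (mul_le_mul_of_nonneg_left (pow_le_pow_right₀ hR1 ?_) hC0)
        omega

end

/-- The terms of the expansion of `D^λ_j` and `t^λ_{jk}` in powers of `λ` in the summation
formula. -/
def seriesTerm (q lam : ℝ) (j l : ℤ) (m n a s M : ℕ) : ℂ :=
  ((qFac q s * coefU q l n s * invFac q a * invFac q (s - m + a) * invFac q (m - a) *
    invFac q (M - a) * invFac q (M + j - (s - m + a)) *
    q ^ (((s : ℝ) - m + 2 * a) ^ 2 / 4 + (j - s + m) * (2 * (l + m + n) + 1) / 4 +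
      (M - a) * (M - a - 1) / 2 + (M - a) * (1 + l + m + n)) : ℝ) : ℂ) *
    (Complex.I * lam) ^ (2 * M + j).toNat

section

variable {q : ℝ} (hq0 : 0 < q) (hq1 : q < 1) (lam : ℝ) (j l : ℤ) (m n : ℕ)

include hq0 hq1

/-- The exponent of `q` has no cross term in `s` and `M`: it splits into quadratics with leading
parts `s²/4` and `M²/2`. All other factors grow at most exponentially, so a product of two
convergent series dominates. -/
theorem summable_seriesTerm (a : ℕ) :
    Summable fun x : ℕ × ℕ => seriesTerm q lam j l m n a x.1 x.2 := by
  obtain ⟨C, R, hR, hC⟩ := exists_abs_coefU_le hq0 hq1 l n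
  have hq' : 0 < (1 - q)⁻¹ := inv_pos.2 (by linarith)
  set Λ : ℝ := |lam| + 1
  have hΛ : 1 ≤ Λ := by simp [Λ]
  have h1 := summable_pow_mul_rpow_quadratic hq0 hq1 (mul_pos hq' hR) (α := 1 / 4) (by norm_num)
    ((2 * a - m) / 2 - (2 * ((l : ℝ) + m + n) + 1) / 4)
    ((2 * a - m) ^ 2 / 4 + (j + m) * (2 * (l + m + n) + 1) / 4)
  have h2 := summable_pow_mul_rpow_quadratic hq0 hq1 (R := Λ ^ 2) (by positivity) (α := 1 / 2)
    (by norm_num) (-a + 1 / 2 + l + m + n) ((a ^ 2 + a) / 2 - a * (1 + l + m + n))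
  have h3 := (h1.mul_of_nonneg h2 (fun s => by have := Real.rpow_nonneg hq0.le; positivity)
    (fun s => by have := Real.rpow_nonneg hq0.le; positivity)).mul_left (C * Λ ^ j.natAbs)
  refine Summable.of_norm_bounded h3 ?_
  rintro ⟨s, M⟩
  have hC0 : 0 ≤ C * R ^ s := (abs_nonneg _).trans (hC s)
  have e1 : ‖(Complex.I * (lam : ℂ)) ^ (2 * (M : ℤ) + j).toNat‖ ≤ (Λ ^ 2) ^ M * Λ ^ j.natAbs := by
    rw [norm_pow, norm_mul, Complex.norm_I, one_mul, Complex.norm_real, Real.norm_eq_abs,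
      ← pow_mul, ← pow_add]
    refine (pow_le_pow_left₀ (abs_nonneg _) (by simp [Λ]) _).trans (pow_le_pow_right₀ hΛ ?_)
    omega
  have e2 : q ^ (((s : ℝ) - m + 2 * a) ^ 2 / 4 + (j - s + m) * (2 * (l + m + n) + 1) / 4 +
      (M - a) * (M - a - 1) / 2 + (M - a) * (1 + l + m + n)) =
      q ^ (1 / 4 * (s : ℝ) ^ 2 + ((2 * a - m) / 2 - (2 * ((l : ℝ) + m + n) + 1) / 4) * s +
        ((2 * a - m) ^ 2 / 4 + (j + m) * (2 * (l + m + n) + 1) / 4)) *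
      q ^ (1 / 2 * (M : ℝ) ^ 2 + (-a + 1 / 2 + l + m + n) * M +
        ((a ^ 2 + a) / 2 - a * (1 + l + m + n))) := by
    rw [← Real.rpow_add hq0]
    congr 1
    ring
  rw [seriesTerm, norm_mul, Complex.norm_real, e2]
  set X := q ^ (1 / 4 * (s : ℝ) ^ 2 + ((2 * a - m) / 2 - (2 * ((l : ℝ) + m + n) + 1) / 4) * s +
        ((2 * a - m) ^ 2 / 4 + (j + m) * (2 * (l + m + n) + 1) / 4)) with hX
  set Y := q ^ (1 / 2 * (M : ℝ) ^ 2 + (-a + 1 / 2 + l + m + n) * M +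
        ((a ^ 2 + a) / 2 - a * (1 + l + m + n))) with hY
  have hX0 : 0 ≤ X := Real.rpow_nonneg hq0.le _
  have hY0 : 0 ≤ Y := Real.rpow_nonneg hq0.le _
  have i := abs_invFac_le_one hq0 hq1
  simp only [norm_mul, Real.norm_eq_abs, abs_of_nonneg hX0, abs_of_nonneg hY0,
    abs_of_pos (qFac_pos hq0 hq1 s)]
  calc qFac q s * |coefU q l n s| * |invFac q a| * |invFac q (s - m + a)| * |invFac q (m - a)| *
      |invFac q (M - a)| * |invFac q (M + j - (s - m + a))| * (X * Y) *
        ‖(Complex.I * (lam : ℂ)) ^ (2 * (M : ℤ) + j).toNat‖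
      ≤ (1 - q)⁻¹ ^ s * (C * R ^ s) * 1 * 1 * 1 * 1 * 1 * (X * Y) *
        ((Λ ^ 2) ^ M * Λ ^ j.natAbs) := by
        gcongr
        · exact qFac_le hq0 hq1 s
        · exact hC s
        · exact i _
        · exact i _
        · exact i _
        · exact i _
        · exact i _
    _ = _ := by
        rw [mul_pow]
        ring

omit hq1 in
-- The substitution `M = a + r` reorganises the series of `t` by the total power of `iλ`.
theorem hasSum_seriesTerm_right (a s : ℕ) {τ : ℂ}
    (hτ : HasSum (fun r : ℕ => ((q ^ (((j : ℝ) ^ 2 - (((s : ℤ) - m : ℤ) : ℝ) ^ 2) / 4 +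
      (j - ((s : ℤ) - m : ℤ)) * ((l + s + n : ℤ) - 2 * ((s : ℤ) - m : ℤ)) / 2 -
        (j - ((s : ℤ) - m : ℤ)) * (j - ((s : ℤ) - m : ℤ) - 1) / 4 + r * (r - 1) / 2 +
        r * (1 - ((s : ℤ) - m : ℤ) + (l + s + n : ℤ))) * invFac q r *
          invFac q (j - ((s : ℤ) - m) + r) : ℝ) : ℂ) *
          (Complex.I * lam) ^ (j - ((s : ℤ) - m) + 2 * r).toNat) τ) :
    HasSum (fun M => seriesTerm q lam j l m n a s M)
      (((qFac q s * coefU q l n s : ℝ) : ℂ) *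
        (((q ^ (((s : ℝ) - m + 2 * a) ^ 2 / 4) * invFac q a * invFac q (s - m + a) *
          invFac q (m - a) : ℝ) : ℂ) * (Complex.I * lam) ^ ((s : ℤ) - m + 2 * a).toNat) * τ) := by
  rw [← Function.Injective.hasSum_iff (add_right_injective a)]
  · refine (hτ.mul_left _).congr_fun fun r => ?_
    simp only [Function.comp_apply]
    rw [seriesTerm]
    have e1 : ((a + r : ℕ) : ℤ) - a = r := by push_cast; ring
    have e2 : ((a + r : ℕ) : ℤ) + j - (s - m + a) = j - (s - m) + r := by push_cast; ring
    rw [e1, e2]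
    -- The exponents add up under `toNat` only if both are nonnegative; otherwise an inverse
    -- factorial makes both terms zero.
    rcases lt_or_ge ((s : ℤ) - m + a) 0 with h | h
    · rw [invFac_of_neg h]; simp
    rcases lt_or_ge (j - ((s : ℤ) - m) + r) 0 with h' | h'
    · rw [invFac_of_neg h']; simp
    have e3 : (2 * ((a + r : ℕ) : ℤ) + j).toNat =
        ((s : ℤ) - m + 2 * a).toNat + (j - ((s : ℤ) - m) + 2 * r).toNat := by
      push_cast
      omega
    have e4 : q ^ (((s : ℝ) - m + 2 * a) ^ 2 / 4 + (j - s + m) * (2 * (l + m + n) + 1) / 4 +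
        ((a + r : ℕ) - a) * ((a + r : ℕ) - a - 1) / 2 + ((a + r : ℕ) - a) * (1 + l + m + n)) =
        q ^ (((s : ℝ) - m + 2 * a) ^ 2 / 4) *
        q ^ (((j : ℝ) ^ 2 - (((s : ℤ) - m : ℤ) : ℝ) ^ 2) / 4 +
          (j - ((s : ℤ) - m : ℤ)) * ((l + s + n : ℤ) - 2 * ((s : ℤ) - m : ℤ)) / 2 -
          (j - ((s : ℤ) - m : ℤ)) * (j - ((s : ℤ) - m : ℤ) - 1) / 4 + r * (r - 1) / 2 +
          r * (1 - ((s : ℤ) - m : ℤ) + (l + s + n : ℤ))) := by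
      rw [← Real.rpow_add hq0]
      congr 1
      push_cast
      ring
    rw [e3, e4, pow_add]
    push_cast
    ring
  · intro M hM
    have hM' : M < a := by
      by_contra h
      exact hM ⟨M - a, by simp; omega⟩
    rw [seriesTerm, invFac_of_neg (show (M : ℤ) - a < 0 by omega)]
    simp

/-- With `s = m - a + c` only `0 ≤ c ≤ b` survives, and the sum over `c` is the expansion of
`δ(z)^b` at `m - a`, namely `sum_lowering`. -/
theorem hasSum_seriesTerm_left {a b M : ℕ} (ha : a ≤ m) (hb : (M : ℤ) + j = b) :
    HasSum (fun s => seriesTerm q lam j l m n a s M)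
      (((q ^ (((M : ℝ) + b) ^ 2 / 4) * invFac q b * (qFac q n * invFac q (n - b)) *
        (invFac q a * invFac q (M - a) *
          q ^ ((((M : ℝ) - a) * (l + m - a + (n - b : ℕ)) + (M - a) * (M - a + 1) / 2) / 2) *
          coefU q l (n - b) (m - a)) : ℝ) : ℂ) *
        (Complex.I * lam) ^ (2 * M + j).toNat) := by
  obtain ⟨d, rfl⟩ := Nat.exists_eq_add_of_le ha
  have hj : j = b - M := by omega
  subst hj
  rw [← Function.Injective.hasSum_iff (add_right_injective d)]
  · have h0 : ∀ c : ℕ, seriesTerm q lam (b - M) l (a + d) n a (d + c) M =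
        ((q ^ (((M : ℝ) + b) ^ 2 / 4) * invFac q a * invFac q (M - a) * invFac q d *
          q ^ ((((M : ℝ) - a) * (l + d + (n - b)) + (M - a) * (M - a + 1) / 2) / 2) *
          (invFac q c * invFac q (b - c) * qFac q (d + c) *
            q ^ ((((b : ℝ) - c) * (l + n + d - c) - (b - c) * (b - c - 1) / 2) / 2) *
            coefU q l n (d + c)) : ℝ) : ℂ) *
          (Complex.I * lam) ^ (2 * (M : ℤ) + (b - M)).toNat := by
      intro c
      have e1 : q ^ ((((d + c : ℕ) : ℝ) - (a + d : ℕ) + 2 * a) ^ 2 / 4 +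
          ((b - M : ℤ) - (d + c : ℕ) + (a + d : ℕ)) * (2 * (l + (a + d : ℕ) + n) + 1) / 4 +
          (M - a) * (M - a - 1) / 2 + (M - a) * (1 + l + (a + d : ℕ) + n)) =
          q ^ (((M : ℝ) + b) ^ 2 / 4) *
          q ^ ((((M : ℝ) - a) * (l + d + (n - b)) + (M - a) * (M - a + 1) / 2) / 2) *
          q ^ ((((b : ℝ) - c) * (l + n + d - c) - (b - c) * (b - c - 1) / 2) / 2) := by
        rw [← Real.rpow_add hq0, ← Real.rpow_add hq0]
        congr 1
        push_cast
        ring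
      have e2 : ((d + c : ℕ) : ℤ) - (a + d : ℕ) + a = c := by push_cast; ring
      have e3 : ((a + d : ℕ) : ℤ) - a = d := by push_cast; ring
      have e4 : (M : ℤ) + (b - M) - c = b - c := by ring
      rw [seriesTerm, e1, e2, e3, e4, Nat.cast_add d c]
      congr 2
      ring
    have h1 : HasSum ((fun s => seriesTerm q lam (b - M) l (a + d) n a s M) ∘ fun c => d + c)
        (∑ c ∈ Finset.range (b + 1), seriesTerm q lam (b - M) l (a + d) n a (d + c) M) := by
      refine hasSum_sum_of_ne_finset_zero fun c hc => ?_
      rw [Finset.mem_range, not_lt] at hc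
      simp only [Function.comp_apply]
      rw [h0, invFac_of_neg (show (b : ℤ) - c < 0 by omega)]
      simp
    convert h1 using 1
    rw [Finset.sum_congr rfl fun c _ => h0 c, ← Finset.sum_mul, ← Complex.ofReal_sum,
      ← Finset.mul_sum, sum_lowering hq0 hq1]
    congr 2
    rcases lt_or_ge n b with h | h
    · rw [invFac_of_neg (show (n : ℤ) - b < 0 by omega)]
      ring
    · have e5 : ((a + d : ℕ) : ℤ) - a = d := by push_cast; ring
      have e6 : (l : ℝ) + (a + d : ℕ) - a + (n - b : ℕ) = l + d + (n - b) := by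
        push_cast [h]; ring
      have h7 := qFac_mul_invFac hq0 hq1 d
      rw [e5, e6]
      linear_combination -(q ^ (((M : ℝ) + b) ^ 2 / 4) * invFac q b *
        (qFac q n * invFac q (n - b)) * (invFac q a * invFac q (M - a) *
          q ^ ((((M : ℝ) - a) * (l + d + (n - b)) + (M - a) * (M - a + 1) / 2) / 2) *
          coefU q l (n - b) d)) * h7
  · intro s hs
    have hs' : s < d := by
      by_contra h
      exact hs ⟨s - d, by simp; omega⟩
    rw [seriesTerm, invFac_of_neg (show (s : ℤ) - (a + d : ℕ) + a < 0 by push_cast; omega)]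
    simp

/-- After the sum over `s`, the sum over `a` is the expansion of `δ(z*)^M`, namely `sum_raising`,
and raises `n - b` to `n - j`. -/
theorem hasSum_sum_seriesTerm_left (M : ℕ) :
    HasSum (fun s => ∑ a ∈ Finset.range (m + 1), seriesTerm q lam j l m n a s M)
      (((q ^ ((2 * (M : ℝ) + j) ^ 2 / 4) * invFac q M * invFac q (M + j) *
        invFac q (n - j - M) * (qFac q n * coefU q l (n - j).toNat m) : ℝ) : ℂ) *
        (Complex.I * lam) ^ (2 * M + j).toNat) := by
  rcases lt_or_ge ((M : ℤ) + j) 0 with h | h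
  · have h0 : ∀ a s, seriesTerm q lam j l m n a s M = 0 := by
      intro a s
      rw [seriesTerm]
      rcases lt_or_ge ((s : ℤ) - m + a) 0 with h' | h'
      · rw [invFac_of_neg h']; simp
      · rw [invFac_of_neg (show (M : ℤ) + j - (s - m + a) < 0 by omega)]; simp
    simp only [h0, Finset.sum_const_zero, invFac_of_neg h]
    simp
  · obtain ⟨b, hb⟩ := Int.eq_ofNat_of_zero_le h
    convert hasSum_sum fun a ha => hasSum_seriesTerm_left hq0 hq1 lam j l m n
      (Nat.lt_succ_iff.1 (Finset.mem_range.1 ha)) hb using 1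
    rw [← Finset.sum_mul, ← Complex.ofReal_sum, ← Finset.mul_sum]
    congr 2
    have hj : j = b - M := by omega
    rcases lt_or_ge n b with h' | h'
    · rw [invFac_of_neg (show (n : ℤ) - j - M < 0 by omega),
        invFac_of_neg (show (n : ℤ) - b < 0 by omega)]
      simp
    · have h1 := sum_raising hq0 hq1 l (n - b) M m
      have h2 : ∑ a ∈ Finset.range (m + 1), invFac q a * invFac q (M - a) *
          q ^ ((((M : ℝ) - a) * (l + m - a + (n - b : ℕ)) + (M - a) * (M - a + 1) / 2) / 2) *
            coefU q l (n - b) (m - a) = invFac q M * coefU q l (n - b + M) m := by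
        rw [← h1]
        -- The cutoffs `m` (from `D`) and `M` (from the binomial) are compared on a common range:
        -- terms with `a > m` vanish by `coefU`, those with `a > M` by `1/(M-a)_q!`.
        have e1 := Finset.sum_subset (Finset.range_mono (show m + 1 ≤ m + M + 1 by omega))
          (f := fun a : ℕ => invFac q a * invFac q (M - a) *
            q ^ ((((M : ℝ) - a) * (l + m - a + (n - b : ℕ)) + (M - a) * (M - a + 1) / 2) / 2) *
            coefU q l (n - b) (m - a)) ?_
        have e2 := Finset.sum_subset (Finset.range_mono (show M + 1 ≤ m + M + 1 by omega))
          (f := fun a : ℕ => invFac q a * invFac q (M - a) *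
            q ^ ((((M : ℝ) - a) * (l + m - a + (n - b : ℕ)) + (M - a) * (M - a + 1) / 2) / 2) *
            coefU q l (n - b) (m - a)) ?_
        · rw [e1, ← e2]
          rfl
        · intro a _ ha
          rw [Finset.mem_range, not_lt] at ha
          rw [invFac_of_neg (show (M : ℤ) - a < 0 by omega)]
          simp
        · intro a _ ha
          rw [Finset.mem_range, not_lt] at ha
          rw [coefU_of_neg _ (show (m : ℤ) - a < 0 by omega), mul_zero]
      rw [h2, hb, show (n : ℤ) - j - M = n - b by omega, show ((n : ℤ) - j).toNat = n - b + M by omega,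
        hj]
      push_cast
      rw [show 2 * (M : ℝ) + (b - M) = M + b by ring]
      ring

/-- Fubini for the absolutely summable double series: summing over `M` first gives the left side of
the formula, over `s` first the right side. -/
theorem hasSum_scalar {τ : ℕ → ℂ}
    (hτ : ∀ s : ℕ, HasSum (fun r : ℕ => ((q ^ (((j : ℝ) ^ 2 - (((s : ℤ) - m : ℤ) : ℝ) ^ 2) / 4 +
      (j - ((s : ℤ) - m : ℤ)) * ((l + s + n : ℤ) - 2 * ((s : ℤ) - m : ℤ)) / 2 -
        (j - ((s : ℤ) - m : ℤ)) * (j - ((s : ℤ) - m : ℤ) - 1) / 4 + r * (r - 1) / 2 +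
        r * (1 - ((s : ℤ) - m : ℤ) + (l + s + n : ℤ))) * invFac q r *
          invFac q (j - ((s : ℤ) - m) + r) : ℝ) : ℂ) *
          (Complex.I * lam) ^ (j - ((s : ℤ) - m) + 2 * r).toNat) (τ s)) :
    HasSum (fun s : ℕ => ∑ a ∈ Finset.range (m + 1), ((qFac q s * coefU q l n s : ℝ) : ℂ) *
        (((q ^ (((s : ℝ) - m + 2 * a) ^ 2 / 4) * invFac q a * invFac q (s - m + a) *
          invFac q (m - a) : ℝ) : ℂ) * (Complex.I * lam) ^ ((s : ℤ) - m + 2 * a).toNat) * τ s)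
      (∑ M ∈ Finset.range ((n : ℤ) - j + 1).toNat,
        ((q ^ ((2 * (M : ℝ) + j) ^ 2 / 4) * invFac q M * invFac q (M + j) *
          invFac q (n - j - M) * (qFac q n * coefU q l (n - j).toNat m) : ℝ) : ℂ) *
          (Complex.I * lam) ^ (2 * M + j).toNat) := by
  have hF : Summable fun x : ℕ × ℕ =>
      ∑ a ∈ Finset.range (m + 1), seriesTerm q lam j l m n a x.1 x.2 :=
    summable_sum fun a _ => summable_seriesTerm hq0 hq1 lam j l m n a
  have h1 := hF.hasSum.prod_fiberwise fun s => hasSum_sum fun a _ =>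
    hasSum_seriesTerm_right hq0 lam j l m n a s (hτ s)
  have h2 := ((Equiv.prodComm ℕ ℕ).hasSum_iff.2 hF.hasSum).prod_fiberwise fun M =>
    hasSum_sum_seriesTerm_left hq0 hq1 lam j l m n M
  -- The factor `1/(n-j-M)_q!` cuts the sum at `M = n - j`; for `n < j` nothing remains, which is
  -- the vanishing case of the formula.
  refine (h2.unique (hasSum_sum_of_ne_finset_zero fun M hM => ?_)) ▸ h1
  rw [Finset.mem_range, not_lt] at hM
  rw [invFac_of_neg (show (n : ℤ) - j - M < 0 by omega)]
  simp

end

/-! ### The summation formula -/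

theorem toL2_add (v w : GrpSpace) : toL2 (v + w) = toL2 v + toL2 w := by
  ext i
  simp [toL2_apply]

theorem toL2_smul (c : ℂ) (v : GrpSpace) : toL2 (c • v) = c • toL2 v := by
  ext i
  simp [toL2_apply]

theorem hasSum_toL2_of_single {T : ℕ → Module.End ℂ GrpSpace} {S : Module.End ℂ GrpSpace}
    (h : ∀ l : ℤ, HasSum (fun s => toL2 (T s (Finsupp.single l 1)))
      (toL2 (S (Finsupp.single l 1)))) (v : GrpSpace) :
    HasSum (fun s => toL2 (T s v)) (toL2 (S v)) := by
  induction v using Finsupp.induction_linear with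
  | zero =>
    have h0 : toL2 0 = 0 := by simp [toL2]
    simp only [map_zero, h0]
    exact hasSum_zero
  | add v w hv hw =>
    simp only [map_add, toL2_add]
    exact hv.add hw
  | single l c =>
    have hc : (Finsupp.single l c : GrpSpace) = c • Finsupp.single l 1 := by simp
    simp only [hc, map_smul, toL2_smul]
    exact (h l).const_smul c

/-- The left-hand side of the summation formula on a basis vector, with the right-hand side as a
finite sum. -/
theorem hasSum_DMat_smul_tOp_mul_UOp {q : ℝ} (hq0 : 0 < q) (hq1 : q < 1) (lam : ℝ) (j l : ℤ)
    (m n : ℕ) :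
    HasSum (fun s : ℕ => toL2 ((DMat q lam ((s : ℤ) - m) m s •
        (tOp q lam j ((s : ℤ) - m) * UOp q s n)) (Finsupp.single l 1)))
      (toL2 (Finsupp.single (l + m + n - j)
        (((Real.sqrt (qExp q (-(q ^ ((l : ℝ) / 2)) ^ 2)) *
          (Real.sqrt (qFac q m) / Real.sqrt (qFac q n)) : ℝ) : ℂ) *
        ∑ M ∈ Finset.range ((n : ℤ) - j + 1).toNat,
        ((q ^ ((2 * (M : ℝ) + j) ^ 2 / 4) * invFac q M * invFac q (M + j) *
          invFac q (n - j - M) * (qFac q n * coefU q l (n - j).toNat m) : ℝ) : ℂ) *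
          (Complex.I * lam) ^ (2 * M + j).toNat))) := by
  -- `U_{sn}` sends `|l⟩` to a multiple of `|l+s+n⟩`, and `t_{j,s-m}` sends that to a multiple of
  -- `|l+m+n-j⟩`. The target is independent of `s`, so only scalars need to converge.
  choose τ hτ1 hτ2 using fun s : ℕ =>
    tOp_single hq0 hq1 lam j ((s : ℤ) - m) (l + s + n)
  have h1 := ((hasSum_scalar hq0 hq1 lam j l m n hτ2).mul_left
    ((Real.sqrt (qExp q (-(q ^ ((l : ℝ) / 2)) ^ 2)) *
      (Real.sqrt (qFac q m) / Real.sqrt (qFac q n)) : ℝ) : ℂ)).smul_const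
    (toL2 (Finsupp.single (l + m + n - j) 1))
  simp only [← toL2_smul, Finsupp.smul_single, smul_eq_mul, mul_one] at h1
  refine h1.congr_fun fun s => ?_
  rw [LinearMap.smul_apply, Module.End.mul_apply, UOp_single hq0 hq1, hτ1, Finsupp.smul_single,
    DMat_eq_sum hq0 hq1, smul_eq_mul]
  have e1 : l + s + n - j - ((s : ℤ) - m) = l + m + n - j := by ring
  rw [e1]
  congr 2
  rw [Finset.sum_mul, Finset.mul_sum]
  refine Finset.sum_congr rfl fun a _ => ?_
  -- One root comes from `D`, the other from `U_{sn}`; together they form the factor `(s)_q!` of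
  -- `sum_lowering`.
  have h3 : Real.sqrt (qFac q s) * Real.sqrt (qFac q s) = qFac q s :=
    Real.mul_self_sqrt (qFac_pos hq0 hq1 s).le
  generalize Real.sqrt (qFac q s) = ss at h3 ⊢
  rw [← h3]
  push_cast
  ring

/-- The summation formula for `j ≤ n`. -/
theorem hasSum_of_le {q : ℝ} (hq0 : 0 < q) (hq1 : q < 1) (lam : ℝ) {j : ℤ} (m : ℕ) {n : ℕ}
    (h : j ≤ n) (v : GrpSpace) :
    HasSum (fun s : ℕ => toL2 ((DMat q lam ((s : ℤ) - m) m s •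
        (tOp q lam j ((s : ℤ) - m) * UOp q s n)) v))
      (toL2 ((DMat q lam j ((n : ℤ) - j).toNat n • UOp q m ((n : ℤ) - j).toNat) v)) := by
  obtain ⟨N, hN⟩ := Int.eq_ofNat_of_zero_le (sub_nonneg.2 h)
  have hj : j = n - N := by omega
  subst hj
  refine hasSum_toL2_of_single (fun l => ?_) v
  convert hasSum_DMat_smul_tOp_mul_UOp hq0 hq1 lam (n - N) l m n using 2
  rw [hN, Int.toNat_natCast, LinearMap.smul_apply, UOp_single hq0 hq1, Finsupp.smul_single,
    DMat_eq_sum hq0 hq1, smul_eq_mul, show l + (m : ℤ) + n - (n - N) = l + m + N by ring,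
    show ((N : ℤ) + 1).toNat = N + 1 by omega]
  congr 1
  rw [Finset.sum_mul, Finset.mul_sum]
  refine Finset.sum_congr rfl fun M _ => ?_
  rw [show (n : ℤ) - N + 2 * M = 2 * M + (n - N) by ring,
    show (n : ℤ) - N + M = M + (n - N) by ring]
  have e1 : (n : ℝ) - N + 2 * M = 2 * M + ((n - N : ℤ) : ℝ) := by push_cast; ring
  have h3 : Real.sqrt (qFac q n) * Real.sqrt (qFac q n) = qFac q n :=
    Real.mul_self_sqrt (qFac_pos hq0 hq1 n).le
  have h4 := (Real.sqrt_pos.2 (qFac_pos hq0 hq1 n)).ne'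
  have h5 := (Real.sqrt_pos.2 (qFac_pos hq0 hq1 N)).ne'
  rw [e1]
  generalize Real.sqrt (qFac q n) = sn at h3 h4 ⊢
  generalize Real.sqrt (qFac q N) = sN at h5 ⊢
  generalize (Complex.I * (lam : ℂ)) ^ (2 * (M : ℤ) + (n - N)).toNat = P
  generalize q ^ ((2 * (M : ℝ) + ((n - N : ℤ) : ℝ)) ^ 2 / 4) = X
  generalize Real.sqrt (qExp q _) = W
  rw [← h3, mul_right_comm _ P, ← mul_assoc _ _ P, ← Complex.ofReal_mul, ← Complex.ofReal_mul]
  congr 2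
  field_simp

/-- The summation formula for `n < j`. -/
theorem hasSum_zero_of_lt {q : ℝ} (hq0 : 0 < q) (hq1 : q < 1) (lam : ℝ) {j : ℤ} (m : ℕ) {n : ℕ}
    (h : n < j) (v : GrpSpace) :
    HasSum (fun s : ℕ => toL2 ((DMat q lam ((s : ℤ) - m) m s •
        (tOp q lam j ((s : ℤ) - m) * UOp q s n)) v)) 0 := by
  have h0 : toL2 0 = 0 := by simp [toL2]
  have h1 := hasSum_toL2_of_single (S := 0) (T := fun s : ℕ => DMat q lam ((s : ℤ) - m) m s •
        (tOp q lam j ((s : ℤ) - m) * UOp q s n)) (fun l => ?_) v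
  · simpa only [LinearMap.zero_apply, h0] using h1
  · convert hasSum_DMat_smul_tOp_mul_UOp hq0 hq1 lam j l m n using 2
    rw [show ((n : ℤ) - j + 1).toNat = 0 by omega]
    simp

end QEuclid

end

theorem mainTheorem2 (q lam : ℝ) (hq0 : 0 < q) (hq1 : q < 1) :
    -- the operators `U_{mn}` are given by q-Kummer functions
    (∀ m n : ℕ, m ≤ n →
      QEuclid.UOp q m n =
        (↑(QEuclid.AOp ^ (-(m : ℤ))) : Module.End ℂ QEuclid.GrpSpace) *
          QEuclid.BStar q ^ (n - m) * QEuclid.etaFun q (QEuclid.PhiFun q m n)) ∧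
    (∀ m n : ℕ, n ≤ m →
      QEuclid.UOp q m n =
        ((q ^ (((m : ℝ) - n) * ((m : ℝ) - n - 1) / 2) : ℝ) : ℂ) •
          ((↑(QEuclid.AOp ^ (-(m : ℤ))) : Module.End ℂ QEuclid.GrpSpace) *
            (-QEuclid.BOp q) ^ (m - n) * QEuclid.etaFun q (QEuclid.PhiFun q n m))) ∧
    -- the summation formula for `n ≥ j`
    (∀ (j : ℤ) (m n : ℕ), j ≤ (n : ℤ) → ∀ v : QEuclid.GrpSpace,
      HasSum
        (fun s : ℕ => QEuclid.toL2
          ((QEuclid.DMat q lam ((s : ℤ) - m) m s •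
            (QEuclid.tOp q lam j ((s : ℤ) - m) * QEuclid.UOp q s n)) v))
        (QEuclid.toL2
          ((QEuclid.DMat q lam j ((n : ℤ) - j).toNat n •
            QEuclid.UOp q m ((n : ℤ) - j).toNat) v))) ∧
    -- the summation formula for `n < j`
    (∀ (j : ℤ) (m n : ℕ), (n : ℤ) < j → ∀ v : QEuclid.GrpSpace,
      HasSum
        (fun s : ℕ => QEuclid.toL2
          ((QEuclid.DMat q lam ((s : ℤ) - m) m s •
            (QEuclid.tOp q lam j ((s : ℤ) - m) * QEuclid.UOp q s n)) v))
        0) := by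
  exact ⟨fun m n h => QEuclid.UOp_eq_of_le hq0 hq1 h, fun m n h => QEuclid.UOp_eq_of_ge hq0 hq1 h,
    fun j m n h v => QEuclid.hasSum_of_le hq0 hq1 lam m h v,
    fun j m n h v => QEuclid.hasSum_zero_of_lt hq0 hq1 lam m h v⟩
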